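/- Fix $\Delta>0$ and an integer $d\ge 0$, and let $M\subset[0,\Delta]^d$ be finite with the $\ell_1$ metric. For distributions $p,q$ on $M$, $EMD(p,q)$ is the minimum of $\sum_{x,y}f(x,y)\|x-y\|_1$ over all $f:M\times M\to[0,\infty)$ with $\sum_y f(x,y)=p(x)$ and $\sum_x f(x,y)=q(y)$. An EMD-closeness tester on $M$ is a randomized algorithm that, given $\varepsilon>0$ and independent samples from $p$ and $q$, accepts with probability at least $2/3$ if $p=q$ and rejects with probability at least $2/3$ if $EMD(p,q)>\varepsilon$. An $\ell_1$-closeness tester with parameters $\varepsilon'>0$, $\delta\in(0,1)$ on a finite set accepts with probability at least $1-\delta$ if $p=q$ and rejects with probability at least $1-\delta$ if $\|p-q\|_1>\varepsilon'$. For $i\ge 1$ let the $i$-coarsening $p^{(i)}$ be the distribution that $p$ induces on the $2^{di}$ cells of the grid of side length $\Delta/2^i$ on $[0,\Delta]^d$. Let $L=\max(0,\lceil\log_2(2\Delta d/\varepsilon)\rceil)$. The algorithm EMD-Closeness-Tester does the following: for $i=1,\dots,L$ it runs, with fresh samples, an $\ell_1$-closeness tester on $p^{(i)},q^{(i)}$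 with distance parameter $\frac{\varepsilon 2^{i-2}}{\Delta d L}$ and failure probability $\frac1{3L}$, and it rejects if that run rejects; if no run rejects, it accepts. Then: 1. Whatever $\ell_1$-closeness tester is used as the subroutine, EMD-Closeness-Tester is an EMD-closeness tester on every finite $M\subset[0,\Delta]^d$. 2. The $\ell_1$-closeness tester can be chosen (once for all $d,\Delta,\varepsilon$) so that EMD-Closeness-Tester takes $\tilde O((2\Delta d/\varepsilon)^{2d/3})$ samples when $d\ge 6$ is fixed, and $\tilde O((\Delta/\varepsilon)^2)$ samples when $d\le 2$. Precisely, there is an integer $k\ge0$ such that for all $\Delta,\varepsilon>0$ the worst-case total number of samples is at most - $C_d\,(2\Delta d/\varepsilon)^{2d/3}\log^k(2+2\Delta d/\varepsilon)$ for each $d\ge 6$, with $C_d$ depending only on $d$; - $C\,(2^{L})^{2d/3}\,(d\log(2+2\Delta d/\varepsilon))^k$ for all $d\ge 6$, with $C$ an absolute constant (here $2^L=2\Delta d/\varepsilon$ if $2\Delta d/\varepsilon\ge1$ is a power of two); - $C'\,(\Delta/\varepsilon)^2\log^k(2+\Delta/\varepsilon)$ for all $d\le 2$, with $C'$ an absolute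 constant. -/

import Mathlib

/-! ### Randomized algorithms with sample access to two unknown distributions -/

/-- A randomized algorithm with output in `α` that can draw fresh independent samples from
two unknown distributions `p` and `q` on `X`, adaptively, and has internal randomness.
Every run terminates, since the type is inductive. -/
inductive SampleAlg (X : Type) (α : Type) : Type where
  /-- stop with output `a` -/
  | ret (a : α) : SampleAlg X α
  /-- draw a fresh sample `x` from `p` and continue with `k x` -/
  | drawP (k : X → SampleAlg X α) : SampleAlg X α
  /-- draw a fresh sample `x` from `q` and continue with `k x` -/
  | drawQ (k : X → SampleAlg X α) : SampleAlg X α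
  /-- draw `n` from the known distribution `μ` (internal randomness) and continue with `k n` -/
  | rand (μ : PMF ℕ) (k : ℕ → SampleAlg X α) : SampleAlg X α

namespace SampleAlg

variable {X Y α β : Type}

/-- The law of the output when the two unknown distributions are `p` and `q`. -/
noncomputable def run (p q : PMF X) : SampleAlg X α → PMF α
  | ret a => PMF.pure a
  | drawP k => p.bind fun x => run p q (k x)
  | drawQ k => q.bind fun x => run p q (k x)
  | rand μ k => μ.bind fun n => run p q (k n)

/-- The number of samples drawn in the worst case, from `p` and `q` together. -/
noncomputable def samples : SampleAlg X α → ℕ∞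
  | ret _ => 0
  | drawP k => 1 + ⨆ x, samples (k x)
  | drawQ k => 1 + ⨆ x, samples (k x)
  | rand _ k => ⨆ n, samples (k n)

/-- Sequential composition. -/
def bind (f : α → SampleAlg X β) : SampleAlg X α → SampleAlg X β
  | ret a => f a
  | drawP k => drawP fun x => bind f (k x)
  | drawQ k => drawQ fun x => bind f (k x)
  | rand μ k => rand μ fun n => bind f (k n)

/-- Run an algorithm for distributions on `Y` with samples from distributions on `X`, by
replacing each sample `x` by `g x`. -/
def comap (g : X → Y) : SampleAlg Y α → SampleAlg X α
  | ret a => ret a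
  | drawP k => drawP fun x => comap g (k (g x))
  | drawQ k => drawQ fun x => comap g (k (g x))
  | rand μ k => rand μ fun n => comap g (k n)

/-- `comap g` is the algorithm run on the distributions that `g` induces on `Y`. -/
theorem run_comap (g : X → Y) (A : SampleAlg Y α) (p q : PMF X) :
    (A.comap g).run p q = A.run (p.map g) (q.map g) := by
  induction A with
  | ret a => rfl
  | drawP k ih => simp [comap, run, ih, PMF.bind_map, Function.comp_def]
  | drawQ k ih => simp [comap, run, ih, PMF.bind_map, Function.comp_def]
  | rand μ k ih => simp [comap, run, ih]

/-- Run the given tests one after the other; reject as soon as one of them rejects, and accept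
if none does (`true` is accept, `false` is reject). -/
def allAccept : List (SampleAlg X Bool) → SampleAlg X Bool
  | [] => ret true
  | A :: As => A.bind fun b => if b then allAccept As else ret false

/-- The probability that the test `A` accepts. -/
noncomputable def acceptProb (A : SampleAlg X Bool) (p q : PMF X) : ℝ := (A.run p q true).toReal

/-- The probability that the test `A` rejects. -/
noncomputable def rejectProb (A : SampleAlg X Bool) (p q : PMF X) : ℝ := (A.run p q false).toReal

end SampleAlg

/-! ### Earth Mover's Distance -/

/-- `f` is a satisfying flow with supply `p` and demand `q`. -/
structure IsSatisfyingFlow {M : Type} [Fintype M] (p q : PMF M) (f : M → M → ℝ) : Prop where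
  nonneg : ∀ x y, 0 ≤ f x y
  supply : ∀ x, ∑ y, f x y = (p x).toReal
  demand : ∀ y, ∑ x, f x y = (q y).toReal

/-- The Earth Mover's Distance of two distributions on a finite metric space: the least cost of
a satisfying flow. -/
noncomputable def EMD {M : Type} [Fintype M] [MetricSpace M] (p q : PMF M) : ℝ :=
  sInf {c : ℝ | ∃ f : M → M → ℝ, IsSatisfyingFlow p q f ∧ c = ∑ x, ∑ y, f x y * dist x y}

/-- `A`, which takes the distance parameter `ε` and samples, is an EMD-closeness tester for
distributions on the finite metric space `M`. -/
def IsEMDClosenessTester {M : Type} [Fintype M] [MetricSpace M]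
    (A : ℝ → SampleAlg M Bool) : Prop :=
  ∀ ε : ℝ, 0 < ε → ∀ p q : PMF M,
    (p = q → 2 / 3 ≤ (A ε).acceptProb p q) ∧
    (ε < EMD p q → 2 / 3 ≤ (A ε).rejectProb p q)

/-! ### Closeness testers for the `ℓ₁` distance -/

/-- The `ℓ₁` distance of two distributions on a finite set. -/
noncomputable def l1Dist {X : Type} [Fintype X] (p q : PMF X) : ℝ :=
  ∑ x, |(p x).toReal - (q x).toReal|

/-- A family of tests: one for each finite domain `X`, distance parameter and failure
probability. -/
abbrev L1Subroutine : Type 1 := ∀ (X : Type) [Fintype X], ℝ → ℝ → SampleAlg X Bool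

/-- `T X ε δ` is an `ℓ₁`-closeness tester on `X` with distance parameter `ε` and failure
probability `δ`. -/
def IsL1ClosenessTester (T : L1Subroutine) : Prop :=
  ∀ (X : Type) [Fintype X] (ε δ : ℝ), 0 < ε → 0 < δ → δ < 1 → ∀ p q : PMF X,
    (p = q → 1 - δ ≤ (T X ε δ).acceptProb p q) ∧
    (ε < l1Dist p q → 1 - δ ≤ (T X ε δ).rejectProb p q)

/-! ### The algorithm -/

/-- `ℝ^d` with the `ℓ₁` metric. -/
abbrev L1Space (d : ℕ) : Type := PiLp 1 (fun _ : Fin d => ℝ)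

/-- The cells of the grid that divides each side of `[0,Δ]^d` into `2^i` intervals. -/
abbrev GridCell (d i : ℕ) : Type := Fin d → Fin (2 ^ i)

/-- The cell, in the grid of side length `Δ / 2^i` over `[0,Δ]^d`, of the point `x`. Cells are
half-open, except that the last cell in each direction contains the face `x j = Δ`. The
`i`-coarsening of `p` is `p.map (gridCell Δ i)`. -/
noncomputable def gridCell {d : ℕ} (Δ : ℝ) (i : ℕ) (x : L1Space d) : GridCell d i := fun j =>
  ⟨min ⌊x j / (Δ / 2 ^ i)⌋₊ (2 ^ i - 1),
    lt_of_le_of_lt (min_le_right _ _) (Nat.sub_lt (Nat.two_pow_pos i) Nat.one_pos)⟩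

/-- The number of grids used: `log₂ (2Δd/ε)`, rounded up (and `0` if this is negative). -/
noncomputable def numScales (d : ℕ) (Δ ε : ℝ) : ℕ := ⌈Real.logb 2 (2 * Δ * d / ε)⌉₊

/-- The algorithm EMD-Closeness-Tester: for `i = 1, …, numScales`, run the `ℓ₁` tester on the
`i`-coarsenings, with fresh samples; reject if one of these runs rejects, otherwise accept. -/
noncomputable def emdClosenessTester (T : L1Subroutine) (d : ℕ) (Δ ε : ℝ) :
    SampleAlg (L1Space d) Bool :=
  SampleAlg.allAccept <| (List.range' 1 (numScales d Δ ε)).map fun i : ℕ =>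
    (T (GridCell d i)
      (ε * (2 : ℝ) ^ ((i : ℤ) - 2) / (Δ * d * numScales d Δ ε))
      (1 / (3 * numScales d Δ ε))).comap (gridCell Δ i)

/-! ### Composed tests: acceptance probabilities and sample counts. -/

namespace SampleAlg

variable {X Y α β : Type}

/-! Correctness rests on a multiscale bound for EMD. Starting at the finest grid and passing to
coarser ones, match as much of the remaining mass as possible inside each cell. At scale `i` the
unmatched mass is half the `ℓ₁` distance of the coarsenings, and matching inside a cell costs at
most its diameter `Δd/2^i` per unit. Summing over scales gives `emd_le_of_l1Dist_le`. If all
coarsenings are within the tested distances, each scale contributes at most `ε/(8L)` and the finest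
grid at most `ε/2`, so EMD is below `ε`. Hence a large EMD is detected at some scale, while a union
bound handles `p = q`.

The sample bounds need an `ℓ₁` tester with about `n^(2/3)/(ε²δ)` samples on `n` points. `flatTester`
uses some samples to choose weights `1/(N + N' + 1)` that damp the heavy elements, then thresholds
the weighted correlation of two independent difference vectors. Its mean is a weighted squared `ℓ₂`
distance, bounded below by Cauchy–Schwarz (`le_sum_flattened`); its variance is controlled by
`diffExp_diffExp_sq_le` and `countExp_flattened_sq_le`, and Chebyshev concludes.

At scale `i` this costs `(2^i)^(2d/3) · 4^(L-i)` up to a factor of order `L³`. The finest scale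
dominates when `2d/3 ≥ 2`, the coarsest when `2d/3 ≤ 2`. -/

theorem run_bind (f : α → SampleAlg X β) (A : SampleAlg X α) (p q : PMF X) :
    (A.bind f).run p q = (A.run p q).bind fun a => (f a).run p q := by
  induction A with
  | ret a => simp [bind, run]
  | drawP k ih => simp [bind, run, ih]
  | drawQ k ih => simp [bind, run, ih]
  | rand μ k ih => simp [bind, run, ih]

theorem acceptProb_add_rejectProb (A : SampleAlg X Bool) (p q : PMF X) :
    A.acceptProb p q + A.rejectProb p q = 1 := by
  have h := (A.run p q).tsum_coe
  rw [tsum_bool] at h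
  rw [acceptProb, rejectProb, ← ENNReal.toReal_add ((A.run p q).apply_ne_top _)
    ((A.run p q).apply_ne_top _), add_comm, h, ENNReal.toReal_one]

theorem acceptProb_nonneg (A : SampleAlg X Bool) (p q : PMF X) : 0 ≤ A.acceptProb p q :=
  ENNReal.toReal_nonneg

theorem acceptProb_le_one (A : SampleAlg X Bool) (p q : PMF X) : A.acceptProb p q ≤ 1 := by
  have h := A.acceptProb_add_rejectProb p q
  have h' : 0 ≤ A.rejectProb p q := ENNReal.toReal_nonneg
  linarith

theorem acceptProb_comap (g : X → Y) (A : SampleAlg Y Bool) (p q : PMF X) :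
    (A.comap g).acceptProb p q = A.acceptProb (p.map g) (q.map g) := by
  rw [acceptProb, acceptProb, run_comap]

theorem rejectProb_comap (g : X → Y) (A : SampleAlg Y Bool) (p q : PMF X) :
    (A.comap g).rejectProb p q = A.rejectProb (p.map g) (q.map g) := by
  rw [rejectProb, rejectProb, run_comap]

theorem acceptProb_allAccept (l : List (SampleAlg X Bool)) (p q : PMF X) :
    (allAccept l).acceptProb p q = (l.map fun A => A.acceptProb p q).prod := by
  induction l with
  | nil => simp [allAccept, acceptProb, run]
  | cons A As ih =>
    rw [List.map_cons, List.prod_cons, ← ih]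
    simp [allAccept, acceptProb, run_bind, PMF.bind_apply, run]

/-- The union bound for a conjunction of tests. -/
theorem one_sub_le_acceptProb_allAccept {l : List (SampleAlg X Bool)} {p q : PMF X} {δ : ℝ}
    (h : ∀ A ∈ l, 1 - δ ≤ A.acceptProb p q) :
    1 - l.length * δ ≤ (allAccept l).acceptProb p q := by
  rw [acceptProb_allAccept]
  suffices (l.map fun A => A.acceptProb p q).prod ≤ 1 ∧
      1 - l.length * δ ≤ (l.map fun A => A.acceptProb p q).prod from this.2
  induction l with
  | nil => simp
  | cons A As ih =>
    obtain ⟨h1, h2⟩ := ih fun B hB => h B (List.mem_cons_of_mem _ hB)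
    have hA := h A List.mem_cons_self
    have hA1 := A.acceptProb_le_one p q
    have hA0 := A.acceptProb_nonneg p q
    have h0 : 0 ≤ (As.map fun A => A.acceptProb p q).prod :=
      List.prod_nonneg (by simp [acceptProb_nonneg])
    simp only [List.map_cons, List.prod_cons, List.length_cons, Nat.cast_add, Nat.cast_one]
    constructor
    · exact mul_le_one₀ hA1 h0 h1
    -- `(1 - a)(1 - Π) ≥ 0` gives `aΠ ≥ a + Π - 1`; this is why `Π ≤ 1` is carried through the
    -- induction.
    · nlinarith [mul_nonneg (sub_nonneg.2 hA1) (sub_nonneg.2 h1)]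

theorem acceptProb_allAccept_le {l : List (SampleAlg X Bool)} {A : SampleAlg X Bool} (hA : A ∈ l)
    (p q : PMF X) : (allAccept l).acceptProb p q ≤ A.acceptProb p q := by
  rw [acceptProb_allAccept]
  induction l with
  | nil => simp at hA
  | cons B Bs ih =>
    have hB1 := B.acceptProb_le_one p q
    have hB0 := B.acceptProb_nonneg p q
    have h0 : 0 ≤ (Bs.map fun A => A.acceptProb p q).prod :=
      List.prod_nonneg (by simp [acceptProb_nonneg])
    have h1 : (Bs.map fun A => A.acceptProb p q).prod ≤ 1 := by
      rw [← acceptProb_allAccept]; exact acceptProb_le_one _ _ _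
    rw [List.map_cons, List.prod_cons]
    rcases List.mem_cons.1 hA with rfl | hA
    · exact mul_le_of_le_one_right hB0 h1
    · exact (mul_le_of_le_one_left h0 hB1).trans (ih hA)

theorem samples_bind_le (f : α → SampleAlg X β) (A : SampleAlg X α) {c : ℕ∞}
    (h : ∀ a, (f a).samples ≤ c) : (A.bind f).samples ≤ A.samples + c := by
  induction A with
  | ret a => simpa [bind, samples] using h a
  | drawP k ih =>
    simp only [bind, samples, add_assoc]
    gcongr
    exact iSup_le fun x => (ih x).trans (by gcongr; exact le_iSup (fun x => (k x).samples) x)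
  | drawQ k ih =>
    simp only [bind, samples, add_assoc]
    gcongr
    exact iSup_le fun x => (ih x).trans (by gcongr; exact le_iSup (fun x => (k x).samples) x)
  | rand μ k ih =>
    simp only [bind, samples]
    exact iSup_le fun x => (ih x).trans (by gcongr; exact le_iSup (fun x => (k x).samples) x)

theorem samples_comap_le (g : X → Y) (A : SampleAlg Y α) :
    (A.comap g).samples ≤ A.samples := by
  induction A with
  | ret a => simp [comap, samples]
  | drawP k ih =>
    simp only [comap, samples]
    gcongr
    exact iSup_le fun x => (ih _).trans (le_iSup (fun x => (k x).samples) _)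
  | drawQ k ih =>
    simp only [comap, samples]
    gcongr
    exact iSup_le fun x => (ih _).trans (le_iSup (fun x => (k x).samples) _)
  | rand μ k ih =>
    simp only [comap, samples]
    exact iSup_le fun x => (ih _).trans (le_iSup (fun x => (k x).samples) _)

theorem samples_allAccept_le (l : List (SampleAlg X Bool)) :
    (allAccept l).samples ≤ (l.map samples).sum := by
  induction l with
  | nil => simp [allAccept, samples]
  | cons A As ih =>
    rw [List.map_cons, List.sum_cons]
    refine samples_bind_le _ _ fun b => ?_
    cases b
    · simp [samples]
    · simpa using ih

/-- Draw `k` samples from `p` and continue with the number of occurrences of each value. -/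
noncomputable def countP [DecidableEq X] : ℕ → ((X → ℕ) → SampleAlg X α) → SampleAlg X α
  | 0, f => f 0
  | k + 1, f => drawP fun x => countP k fun N => f (N + Pi.single x 1)

/-- Draw `k` samples from `q` and continue with the number of occurrences of each value. -/
noncomputable def countQ [DecidableEq X] : ℕ → ((X → ℕ) → SampleAlg X α) → SampleAlg X α
  | 0, f => f 0
  | k + 1, f => drawQ fun x => countQ k fun N => f (N + Pi.single x 1)

theorem samples_countP_le [DecidableEq X] (k : ℕ) (f : (X → ℕ) → SampleAlg X α) {c : ℕ∞}
    (h : ∀ N, (f N).samples ≤ c) : (countP k f).samples ≤ k + c := by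
  induction k generalizing f with
  | zero => simpa [countP] using h 0
  | succ k ih =>
    simp only [countP, samples]
    rw [Nat.cast_add, Nat.cast_one, add_comm (k : ℕ∞), add_assoc]
    gcongr
    exact iSup_le fun x => ih _ fun N => h _

theorem samples_countQ_le [DecidableEq X] (k : ℕ) (f : (X → ℕ) → SampleAlg X α) {c : ℕ∞}
    (h : ∀ N, (f N).samples ≤ c) : (countQ k f).samples ≤ k + c := by
  induction k generalizing f with
  | zero => simpa [countQ] using h 0
  | succ k ih =>
    simp only [countQ, samples]
    rw [Nat.cast_add, Nat.cast_one, add_comm (k : ℕ∞), add_assoc]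
    gcongr
    exact iSup_le fun x => ih _ fun N => h _

end SampleAlg

/-! ### Expectations over the counts of independent samples -/

section CountExp

variable {X : Type} [Fintype X] [DecidableEq X]

/-- The expectation of a function of the numbers of occurrences of the elements of `X` among
`k` independent samples of law `P`. -/
noncomputable def countExp (P : X → ℝ) : ℕ → (((X → ℕ) → ℝ) →ₗ[ℝ] ℝ)
  | 0 => LinearMap.proj 0
  | k + 1 => ∑ x, P x • (countExp P k ∘ₗ LinearMap.funLeft ℝ ℝ fun N => N + Pi.single x 1)

theorem countExp_zero (P : X → ℝ) (F : (X → ℕ) → ℝ) : countExp P 0 F = F 0 := rfl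

theorem countExp_succ (P : X → ℝ) (k : ℕ) (F : (X → ℕ) → ℝ) :
    countExp P (k + 1) F = ∑ x, P x * countExp P k fun N => F (N + Pi.single x 1) := by
  simp only [countExp, LinearMap.sum_apply, LinearMap.smul_apply, LinearMap.comp_apply, smul_eq_mul]
  rfl

theorem countExp_add (P : X → ℝ) (k : ℕ) (F G : (X → ℕ) → ℝ) :
    (countExp P k fun N => F N + G N) = countExp P k F + countExp P k G :=
  map_add (countExp P k) F G

theorem countExp_const_mul (P : X → ℝ) (k : ℕ) (c : ℝ) (F : (X → ℕ) → ℝ) :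
    (countExp P k fun N => c * F N) = c * countExp P k F :=
  map_smul (countExp P k) c F

theorem countExp_sum {ι : Type*} (s : Finset ι) (P : X → ℝ) (k : ℕ) (F : ι → (X → ℕ) → ℝ) :
    (countExp P k fun N => ∑ i ∈ s, F i N) = ∑ i ∈ s, countExp P k (F i) := by
  rw [← map_sum]
  congr 1
  ext N
  simp

theorem countExp_const {P : X → ℝ} (hP : ∑ x, P x = 1) (k : ℕ) (c : ℝ) :
    (countExp P k fun _ => c) = c := by
  induction k with
  | zero => rfl
  | succ k ih => simp only [countExp_succ, ih, ← Finset.sum_mul, hP, one_mul]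

theorem countExp_mono {P : X → ℝ} (hP : ∀ x, 0 ≤ P x) (k : ℕ) {F G : (X → ℕ) → ℝ}
    (h : ∀ N, ∑ x, N x = k → F N ≤ G N) : countExp P k F ≤ countExp P k G := by
  induction k generalizing F G with
  | zero => exact h 0 (by simp)
  | succ k ih =>
    simp only [countExp_succ]
    refine Finset.sum_le_sum fun x _ => mul_le_mul_of_nonneg_left (ih fun N hN => h _ ?_) (hP x)
    simp [Finset.sum_add_distrib, hN]

/-- The size-biasing identity. -/
theorem countExp_apply_mul (P : X → ℝ) (k : ℕ) (x : X) (F : (X → ℕ) → ℝ) :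
    (countExp P (k + 1) fun N => N x * F N) =
      (k + 1) * P x * countExp P k fun N => F (N + Pi.single x 1) := by
  -- Conditioning on the first sample `y`: the count of `x` is its count among the other `k`
  -- samples, plus one if `y = x`.
  have key (k : ℕ) (F : (X → ℕ) → ℝ) : (countExp P (k + 1) fun N => N x * F N) =
      (∑ y, P y * countExp P k fun N => N x * F (N + Pi.single y 1)) +
        P x * countExp P k fun N => F (N + Pi.single x 1) := by
    have h (y : X) : P y * (countExp P k fun N =>
        (((N + Pi.single y 1 : X → ℕ) x : ℕ) : ℝ) * F (N + Pi.single y 1)) =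
        (P y * countExp P k fun N => N x * F (N + Pi.single y 1)) +
          if x = y then P y * (countExp P k fun N => F (N + Pi.single y 1)) else 0 := by
      simp only [Pi.add_apply, Nat.cast_add, add_mul, countExp_add, countExp_const_mul, mul_add,
        Pi.single_apply]
      split_ifs <;> simp
    rw [countExp_succ, Finset.sum_congr rfl fun y _ => h y, Finset.sum_add_distrib]
    simp
  induction k generalizing F with
  | zero => rw [key]; simp [countExp_zero]
  | succ k ih =>
    rw [key, Finset.sum_congr rfl fun y _ => by rw [ih]]
    have : ∑ y, P y * ((k + 1) * P x *
        countExp P k fun N => F (N + Pi.single x 1 + Pi.single y 1)) =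
        (k + 1) * P x * countExp P (k + 1) fun N => F (N + Pi.single x 1) := by
      rw [countExp_succ, Finset.mul_sum]
      refine Finset.sum_congr rfl fun y _ => ?_
      simp only [add_right_comm _ (Pi.single x 1)]
      ring
    rw [this]
    push_cast
    ring

/-- Size-biasing applied to `F N = (N x)⁻¹`: the left side is the expectation of `N x * (N x)⁻¹`,
which is at most 1 (and 0 where `N x = 0`), while the shift turns the inverse into `(N x + 1)⁻¹`. -/
theorem mul_countExp_inv_le {P : X → ℝ} (hP : ∀ x, 0 ≤ P x) (hP1 : ∑ x, P x = 1) (k : ℕ) (x : X) :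
    P x * (countExp P k fun N => ((N x : ℝ) + 1)⁻¹) ≤ 1 / (k + 1) := by
  have h := countExp_apply_mul P k x fun N => ((N x : ℝ))⁻¹
  have h1 : (countExp P (k + 1) fun N => (N x : ℝ) * ((N x : ℝ))⁻¹) ≤ 1 := by
    refine (countExp_mono hP _ fun N _ => ?_).trans_eq (countExp_const hP1 (k + 1) 1)
    exact mul_inv_le_one
  rw [h] at h1
  simp only [Pi.add_apply, Pi.single_eq_same, Nat.cast_add, Nat.cast_one] at h1
  rw [le_div_iff₀ (by positivity)]
  linarith

/-- Variance plus squared mean of a sum of `k` independent variables, shifted by `c`. The free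
constant `c` absorbs the contribution of the first sample in the induction. -/
theorem countExp_sq {P : X → ℝ} (hP : ∑ x, P x = 1) (k : ℕ) (u : X → ℝ) (c : ℝ) :
    (countExp P k fun N => (∑ x, u x * N x + c) ^ 2) =
      k * (∑ x, u x ^ 2 * P x - (∑ x, u x * P x) ^ 2) + (k * ∑ x, u x * P x + c) ^ 2 := by
  induction k generalizing c with
  | zero => simp [countExp_zero]
  | succ k ih =>
    set V := ∑ x, u x ^ 2 * P x with hV
    set μ := ∑ x, u x * P x with hμ
    have h (y : X) : (countExp P k fun N => (∑ x, u x * ((N + Pi.single y 1 : X → ℕ) x : ℕ) + c) ^ 2) =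
        k * (V - μ ^ 2) + (k * μ + (u y + c)) ^ 2 := by
      rw [← ih]
      congr 1
      ext N
      simp [mul_add, Finset.sum_add_distrib, Pi.single_apply, add_assoc]
    rw [countExp_succ, Finset.sum_congr rfl fun y _ => by rw [h]]
    have h2 (y : X) : P y * (k * (V - μ ^ 2) + (k * μ + (u y + c)) ^ 2) =
        u y ^ 2 * P y + (2 * (k * μ + c)) * (u y * P y) +
          (k * (V - μ ^ 2) + (k * μ + c) ^ 2) * P y := by ring
    rw [Finset.sum_congr rfl fun y _ => h2 y, Finset.sum_add_distrib, Finset.sum_add_distrib,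
      ← Finset.mul_sum, ← Finset.mul_sum, hP, ← hV, ← hμ]
    push_cast
    ring

/-- The expectation of a function of the difference of the counts of `m` samples of law `P` and
`m` samples of law `Q`. -/
noncomputable def diffExp (P Q : X → ℝ) (m : ℕ) (F : (X → ℝ) → ℝ) : ℝ :=
  countExp P m fun N => countExp Q m fun N' => F fun x => N x - N' x

variable {P Q : X → ℝ}

theorem diffExp_mono (hP : ∀ x, 0 ≤ P x) (hQ : ∀ x, 0 ≤ Q x) (m : ℕ) {F G : (X → ℝ) → ℝ}
    (h : ∀ A, F A ≤ G A) : diffExp P Q m F ≤ diffExp P Q m G :=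
  countExp_mono hP m fun _ _ => countExp_mono hQ m fun _ _ => h _

theorem diffExp_add (P Q : X → ℝ) (m : ℕ) (F G : (X → ℝ) → ℝ) :
    (diffExp P Q m fun A => F A + G A) = diffExp P Q m F + diffExp P Q m G := by
  simp only [diffExp, countExp_add]

theorem diffExp_const_mul (P Q : X → ℝ) (m : ℕ) (c : ℝ) (F : (X → ℝ) → ℝ) :
    (diffExp P Q m fun A => c * F A) = c * diffExp P Q m F := by
  simp only [diffExp, countExp_const_mul]

theorem diffExp_sum {ι : Type*} (s : Finset ι) (P Q : X → ℝ) (m : ℕ) (F : ι → (X → ℝ) → ℝ) :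
    (diffExp P Q m fun A => ∑ i ∈ s, F i A) = ∑ i ∈ s, diffExp P Q m (F i) := by
  simp only [diffExp, countExp_sum]

theorem diffExp_sq_le (hP1 : ∑ x, P x = 1) (hQ1 : ∑ x, Q x = 1) (m : ℕ) (u : X → ℝ) (c : ℝ) :
    (diffExp P Q m fun A => (∑ x, u x * A x + c) ^ 2) ≤
      m * ∑ x, u x ^ 2 * (P x + Q x) + (m * ∑ x, u x * (P x - Q x) + c) ^ 2 := by
  have h (N : X → ℕ) : (countExp Q m fun N' => (∑ x, u x * ((N x : ℝ) - N' x) + c) ^ 2) =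
      m * (∑ x, u x ^ 2 * Q x - (∑ x, u x * Q x) ^ 2) +
        (∑ x, u x * N x + (c - m * ∑ x, u x * Q x)) ^ 2 := by
    have h1 := countExp_sq hQ1 m (fun x => - u x) (∑ x, u x * N x + c)
    simp only [neg_sq, neg_mul, Finset.sum_neg_distrib, mul_neg] at h1
    calc _ = _ := by
          congr 1
          ext N'
          simp only [mul_sub, Finset.sum_sub_distrib]
          ring
      _ = _ := h1
      _ = _ := by ring
  simp only [diffExp, h, countExp_add, countExp_const hP1, countExp_sq hP1]
  simp only [mul_add, mul_sub, Finset.sum_add_distrib, Finset.sum_sub_distrib]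
  have := mul_nonneg m.cast_nonneg (sq_nonneg (∑ x, u x * P x))
  have := mul_nonneg m.cast_nonneg (sq_nonneg (∑ x, u x * Q x))
  have e : (m * ∑ x, u x * P x - m * ∑ x, u x * Q x + c) =
    (m * ∑ x, u x * P x + (c - m * ∑ x, u x * Q x)) := by ring
  rw [e]
  linarith

/-- The variance of the weighted correlation of two independent difference counts. -/
theorem diffExp_diffExp_sq_le (hP : ∀ x, 0 ≤ P x) (hQ : ∀ x, 0 ≤ Q x)
    (hP1 : ∑ x, P x = 1) (hQ1 : ∑ x, Q x = 1) (m : ℕ) (w : X → ℝ) :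
    (diffExp P Q m fun A => diffExp P Q m fun B =>
      (∑ x, w x * A x * B x - m ^ 2 * ∑ x, w x * (P x - Q x) ^ 2) ^ 2) ≤
      m ^ 2 * ∑ x, w x ^ 2 * (P x + Q x) ^ 2 +
        2 * m ^ 3 * ∑ x, w x ^ 2 * (P x + Q x) * (P x - Q x) ^ 2 := by
  set s := ∑ x, w x * (P x - Q x) ^ 2 with hs
  have h1 : (diffExp P Q m fun A => diffExp P Q m fun B =>
      (∑ x, w x * A x * B x - m ^ 2 * s) ^ 2) ≤
      diffExp P Q m fun A => ∑ x, (m * (w x ^ 2 * (P x + Q x))) * (A x) ^ 2 +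
        m ^ 2 * (∑ x, (w x * (P x - Q x)) * A x + (- (m * s))) ^ 2 := by
    -- For fixed `A` the correlation is a linear statistic of `B` with coefficients `w x * A x`. The
    -- resulting bound is quadratic in `A`, so the same second-moment estimate is used again for
    -- `A`.
    refine diffExp_mono hP hQ m fun A => ?_
    refine (diffExp_sq_le hP1 hQ1 m (fun x => w x * A x) (-(m ^ 2 * s))).trans_eq ?_
    rw [Finset.mul_sum]
    have e : ∑ x, w x * A x * (P x - Q x) = ∑ x, (w x * (P x - Q x)) * A x :=
      Finset.sum_congr rfl fun x _ => by ring
    rw [e]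
    congr 1
    · exact Finset.sum_congr rfl fun x _ => by ring
    · ring
  refine h1.trans ?_
  rw [diffExp_add, diffExp_sum, diffExp_const_mul]
  simp only [diffExp_const_mul]
  have h2 (x : X) : (diffExp P Q m fun A => (A x) ^ 2) ≤
      m * (P x + Q x) + (m * (P x - Q x)) ^ 2 := by
    simpa [Pi.single_apply] using diffExp_sq_le hP1 hQ1 m (Pi.single x 1) 0
  have h3 := diffExp_sq_le hP1 hQ1 m (fun x => w x * (P x - Q x)) (-(m * s))
  have e : ∑ x, w x * (P x - Q x) * (P x - Q x) = s :=
    Finset.sum_congr rfl fun x _ => by ring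
  rw [e] at h3
  refine (add_le_add (Finset.sum_le_sum fun x _ => mul_le_mul_of_nonneg_left (h2 x)
    (mul_nonneg m.cast_nonneg (mul_nonneg (sq_nonneg _) (add_nonneg (hP x) (hQ x)))))
    (mul_le_mul_of_nonneg_left h3 (by positivity))).trans_eq ?_
  simp only [Finset.mul_sum, add_neg_cancel, zero_pow two_ne_zero, add_zero]
  rw [← Finset.sum_add_distrib, ← Finset.sum_add_distrib]
  exact Finset.sum_congr rfl fun x _ => by ring

end CountExp

/-! ### A closeness tester for the `ℓ₁` distance -/

theorem PMF.sum_toReal {X : Type} [Fintype X] (p : PMF X) : ∑ x, (p x).toReal = 1 := by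
  rw [← ENNReal.toReal_sum fun x _ => p.apply_ne_top x, ← tsum_fintype (L := .unconditional X),
    p.tsum_coe, ENNReal.toReal_one]

/-- Cauchy–Schwarz, with inverse weights summing to `|X| + 2k`. It holds for every outcome of the
weighting samples, so an `ℓ₁` gap always yields a gap in the mean of the statistic. -/
theorem le_sum_flattened {X : Type} [Fintype X] (k : ℕ) {N N' : X → ℕ} (hN : ∑ x, N x = k) (hN' : ∑ x, N' x = k)
    (v : X → ℝ) : (∑ x, |v x|) ^ 2 / (Fintype.card X + 2 * k) ≤
      ∑ x, (N x + N' x + 1 : ℝ)⁻¹ * v x ^ 2 := by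
  have h := Finset.sq_sum_div_le_sum_sq_div Finset.univ (fun x => |v x|)
    (g := fun x => (N x + N' x + 1 : ℝ)) fun x _ => by positivity
  have e : ∑ x, (N x + N' x + 1 : ℝ) = Fintype.card X + 2 * k := by
    rw [Finset.sum_add_distrib, Finset.sum_add_distrib]
    norm_cast
    simp [hN, hN']
    ring
  rw [e] at h
  refine h.trans_eq (Finset.sum_congr rfl fun x _ => ?_)
  rw [sq_abs, div_eq_inv_mul]

section FlattenedTester

variable {X : Type} [Fintype X] [DecidableEq X] {P Q : X → ℝ}

/-- The expected weighted `ℓ₂` norm after flattening. -/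
theorem countExp_flattened_sq_le (hP : ∀ x, 0 ≤ P x) (hQ : ∀ x, 0 ≤ Q x)
    (hP1 : ∑ x, P x = 1) (hQ1 : ∑ x, Q x = 1) (k : ℕ) :
    (countExp P k fun N => countExp Q k fun N' =>
      ∑ x, ((N x + N' x + 1 : ℝ)⁻¹) ^ 2 * (P x + Q x) ^ 2) ≤ 4 / (k + 1) := by
  have hpt (N N' : X → ℕ) : ∑ x, ((N x + N' x + 1 : ℝ)⁻¹) ^ 2 * (P x + Q x) ^ 2 ≤
      ∑ x, (2 * P x ^ 2) * ((N x : ℝ) + 1)⁻¹ + ∑ x, (2 * Q x ^ 2) * ((N' x : ℝ) + 1)⁻¹ := by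
    rw [← Finset.sum_add_distrib]
    refine Finset.sum_le_sum fun x _ => ?_
    set w := (N x + N' x + 1 : ℝ)⁻¹ with hw
    have h0 : 0 ≤ w := by positivity
    have hx : (0 : ℝ) ≤ N x := Nat.cast_nonneg _
    have hx' : (0 : ℝ) ≤ N' x := Nat.cast_nonneg _
    have h1 : w ≤ 1 := inv_le_one_of_one_le₀ (by linarith)
    have hN : w ≤ ((N x : ℝ) + 1)⁻¹ := by
      rw [hw]; gcongr; linarith
    have hN' : w ≤ ((N' x : ℝ) + 1)⁻¹ := by
      rw [hw]; gcongr; linarith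
    -- One factor `w ≤ 1` is dropped; the other is compared with a weight depending on `N` alone or
    -- on `N'` alone, so that `mul_countExp_inv_le` applies to each distribution separately.
    calc w ^ 2 * (P x + Q x) ^ 2 ≤ w * (2 * P x ^ 2 + 2 * Q x ^ 2) := by
          gcongr
          · nlinarith
          · nlinarith [sq_nonneg (P x - Q x)]
      _ = (2 * P x ^ 2) * w + (2 * Q x ^ 2) * w := by ring
      _ ≤ _ := by gcongr
  refine (countExp_mono hP k fun N _ => countExp_mono hQ k fun N' _ => hpt N N').trans ?_
  simp only [countExp_add, countExp_sum, countExp_const_mul, countExp_const hP1,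
    countExp_const hQ1]
  have hb {R : X → ℝ} (hR : ∀ x, 0 ≤ R x) (hR1 : ∑ x, R x = 1) :
      ∑ x, 2 * R x ^ 2 * (countExp R k fun N => ((N x : ℝ) + 1)⁻¹) ≤ 2 / ((k : ℝ) + 1) := by
    calc _ ≤ ∑ x, R x * (2 / ((k : ℝ) + 1)) := Finset.sum_le_sum fun x _ => by
          have := mul_le_mul_of_nonneg_left (mul_countExp_inv_le hR hR1 k x) (hR x)
          calc _ = 2 * (R x * (R x * (countExp R k fun N => ((N x : ℝ) + 1)⁻¹))) := by ring
            _ ≤ 2 * (R x * (1 / (k + 1))) := by linarith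
            _ = _ := by ring
      _ = _ := by rw [← Finset.sum_mul, hR1, one_mul]
  refine (add_le_add (hb hP hP1) (hb hQ hQ1)).trans_eq ?_
  ring

/-- Chebyshev for equal distributions: the statistic has mean zero and the cubic variance term
vanishes. -/
theorem diffExp_reject_le (hP : ∀ x, 0 ≤ P x) (hP1 : ∑ x, P x = 1) (m : ℕ) (w : X → ℝ) {t : ℝ}
    (ht : 0 < t) :
    (diffExp P P m fun A => diffExp P P m fun B =>
      if ∑ x, w x * A x * B x < t then (0 : ℝ) else 1) ≤
      m ^ 2 / t ^ 2 * ∑ x, w x ^ 2 * (P x + P x) ^ 2 := by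
  have h := diffExp_diffExp_sq_le hP hP hP1 hP1 m w
  simp only [sub_self, zero_pow two_ne_zero, mul_zero, Finset.sum_const_zero, add_zero,
    sub_zero] at h
  calc _ ≤ diffExp P P m fun A => diffExp P P m fun B =>
        (t ^ 2)⁻¹ * (∑ x, w x * A x * B x) ^ 2 := by
        refine diffExp_mono hP hP m fun A => diffExp_mono hP hP m fun B => ?_
        split_ifs with hZ
        · positivity
        · rw [← div_eq_inv_mul, one_le_div₀ (by positivity)]
          exact pow_le_pow_left₀ ht.le (not_lt.1 hZ) 2
    _ ≤ (t ^ 2)⁻¹ * (m ^ 2 * ∑ x, w x ^ 2 * (P x + P x) ^ 2) := by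
        simp only [diffExp_const_mul]
        exact mul_le_mul_of_nonneg_left h (by positivity)
    _ = _ := by ring

/-- Chebyshev for a statistic with mean `m² s`, `s ≥ s₀`, and threshold at most half the mean. The
bound is kept linear in `∑ w² (P + Q)²` because the expectation of that sum over the random weights
is what `countExp_flattened_sq_le` controls. -/
theorem diffExp_accept_le (hP : ∀ x, 0 ≤ P x) (hQ : ∀ x, 0 ≤ Q x)
    (hP1 : ∑ x, P x = 1) (hQ1 : ∑ x, Q x = 1) {m : ℕ} (hm : 0 < m) {w : X → ℝ}
    (hw : ∀ x, 0 ≤ w x) {s₀ δ : ℝ} (hs₀ : 0 < s₀) (hδ : 0 < δ) (hδ1 : δ < 1)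
    (hs : s₀ ≤ ∑ x, w x * (P x - Q x) ^ 2) :
    (diffExp P Q m fun A => diffExp P Q m fun B =>
      if ∑ x, w x * A x * B x < m ^ 2 * s₀ / 2 then (1 : ℝ) else 0) ≤
      δ / 2 + 36 / (δ * m ^ 2 * s₀ ^ 2) * ∑ x, w x ^ 2 * (P x + Q x) ^ 2 := by
  have h := diffExp_diffExp_sq_le hP hQ hP1 hQ1 m w
  set s := ∑ x, w x * (P x - Q x) ^ 2 with hs_def
  set b := ∑ x, w x ^ 2 * (P x + Q x) ^ 2 with hb_def
  have hm' : (0 : ℝ) < m := Nat.cast_pos.2 hm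
  have hs0 : 0 < s := hs₀.trans_le hs
  have hb0 : 0 ≤ b := Finset.sum_nonneg fun x _ => by positivity
  -- Each `w x (P x + Q x)` is at most `√b`, since its square is one term of `b`.
  have hγ : ∑ x, w x ^ 2 * (P x + Q x) * (P x - Q x) ^ 2 ≤ √b * s := by
    rw [hs_def, Finset.mul_sum]
    refine Finset.sum_le_sum fun x _ => ?_
    have : w x * (P x + Q x) ≤ √b := by
      refine Real.le_sqrt_of_sq_le ?_
      rw [mul_pow]
      exact Finset.single_le_sum (f := fun x => w x ^ 2 * (P x + Q x) ^ 2)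
        (fun x _ => by positivity) (Finset.mem_univ x)
    calc _ = (w x * (P x + Q x)) * (w x * (P x - Q x) ^ 2) := by ring
      _ ≤ _ := mul_le_mul_of_nonneg_right this (mul_nonneg (hw x) (sq_nonneg _))
  have hms : 0 < m ^ 2 * s / 2 := by positivity
  have h1 : (diffExp P Q m fun A => diffExp P Q m fun B =>
      if ∑ x, w x * A x * B x < m ^ 2 * s₀ / 2 then (1 : ℝ) else 0) ≤
      ((m ^ 2 * s / 2) ^ 2)⁻¹ * (m ^ 2 * b + 2 * m ^ 3 * (√b * s)) := by
    calc _ ≤ diffExp P Q m fun A => diffExp P Q m fun B =>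
          ((m ^ 2 * s / 2) ^ 2)⁻¹ * (∑ x, w x * A x * B x - m ^ 2 * s) ^ 2 := by
          refine diffExp_mono hP hQ m fun A => diffExp_mono hP hQ m fun B => ?_
          split_ifs with hZ
          · rw [← div_eq_inv_mul, one_le_div₀ (by positivity), ← neg_sq (_ - _)]
            refine pow_le_pow_left₀ hms.le ?_ 2
            have : (m : ℝ) ^ 2 * s₀ ≤ m ^ 2 * s := by gcongr
            linarith
          · positivity
      _ ≤ _ := by
          simp only [diffExp_const_mul]
          refine mul_le_mul_of_nonneg_left (h.trans ?_) (by positivity)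
          gcongr
  refine h1.trans ?_
  set z := √b / (m * s₀) with hz
  have hz0 : 0 ≤ z := by positivity
  have hzs : √b / (m * s) ≤ z := by rw [hz]; gcongr
  have hzs0 : 0 ≤ √b / (m * s) := by positivity
  have e1 : ((m ^ 2 * s / 2) ^ 2)⁻¹ * (m ^ 2 * b + 2 * m ^ 3 * (√b * s)) =
      4 * (√b / (m * s)) ^ 2 + 8 * (√b / (m * s)) := by
    rw [div_pow (√b), Real.sq_sqrt hb0]
    field_simp
    ring
  have e2 : 36 / (δ * m ^ 2 * s₀ ^ 2) * b = 36 / δ * z ^ 2 := by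
    rw [hz, div_pow, Real.sq_sqrt hb0]
    field_simp
  rw [e1, e2]
  have h4 : 4 * z ^ 2 ≤ 4 / δ * z ^ 2 := by
    gcongr
    rw [le_div_iff₀ hδ]; linarith
  -- AM–GM removes the term linear in `z`, that is in `√b`; the total coefficient is `36 = 4 + 32`.
  have h5 : 8 * z ≤ δ / 2 + 32 / δ * z ^ 2 := by
    have : 0 ≤ (δ - 8 * z) ^ 2 / (2 * δ) := by positivity
    have e : (δ - 8 * z) ^ 2 / (2 * δ) = δ / 2 + 32 / δ * z ^ 2 - 8 * z := by
      field_simp; ring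
    linarith
  have e3 : 36 / δ * z ^ 2 = 4 / δ * z ^ 2 + 32 / δ * z ^ 2 := by ring
  have : (√b / (m * s)) ^ 2 ≤ z ^ 2 := pow_le_pow_left₀ hzs0 hzs 2
  linarith

/-! ### The flattening test as a sampling program, and its error probabilities. -/

namespace SampleAlg

theorem toReal_run_countP {α : Type} (k : ℕ) (f : (X → ℕ) → SampleAlg X α) (p q : PMF X) (a : α) :
    ((countP k f).run p q a).toReal =
      countExp (fun x => (p x).toReal) k fun N => ((f N).run p q a).toReal := by
  induction k generalizing f with
  | zero => rfl
  | succ k ih =>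
    rw [countExp_succ, countP, run, PMF.bind_apply, tsum_fintype, ENNReal.toReal_sum
      fun x _ => ENNReal.mul_ne_top (p.apply_ne_top _) (PMF.apply_ne_top _ _)]
    simp only [ENNReal.toReal_mul, ih]

theorem toReal_run_countQ {α : Type} (k : ℕ) (f : (X → ℕ) → SampleAlg X α) (p q : PMF X) (a : α) :
    ((countQ k f).run p q a).toReal =
      countExp (fun x => (q x).toReal) k fun N => ((f N).run p q a).toReal := by
  induction k generalizing f with
  | zero => rfl
  | succ k ih =>
    rw [countExp_succ, countQ, run, PMF.bind_apply, tsum_fintype, ENNReal.toReal_sum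
      fun x _ => ENNReal.mul_ne_top (q.apply_ne_top _) (PMF.apply_ne_top _ _)]
    simp only [ENNReal.toReal_mul, ih]

/-- The flattening test: `k` samples from each distribution give weights, and the test compares
the weighted correlation of two independent difference counts, from `m` samples of each
distribution, with the threshold `t`. -/
noncomputable def flatTest (X : Type) [Fintype X] [DecidableEq X] (k m : ℕ) (t : ℝ) :
    SampleAlg X Bool :=
  countP k fun N => countQ k fun N' =>
    countP m fun A => countQ m fun A' => countP m fun B => countQ m fun B' =>
      ret (decide (∑ x, (N x + N' x + 1 : ℝ)⁻¹ * ((A x : ℝ) - A' x) * ((B x : ℝ) - B' x) < t))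

theorem samples_flatTest_le (k m : ℕ) (t : ℝ) :
    (flatTest X k m t).samples ≤ ((2 * k + 4 * m : ℕ) : ℕ∞) := by
  have h : (flatTest X k m t).samples ≤ k + (k + (m + (m + (m + (m + (0 : ℕ∞)))))) :=
    samples_countP_le _ _ fun _ => samples_countQ_le _ _ fun _ => samples_countP_le _ _ fun _ =>
      samples_countQ_le _ _ fun _ => samples_countP_le _ _ fun _ => samples_countQ_le _ _
        fun _ => le_rfl
  refine h.trans_eq ?_
  norm_cast
  omega

theorem acceptProb_flatTest (k m : ℕ) (t : ℝ) (p q : PMF X) :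
    (flatTest X k m t).acceptProb p q =
      countExp (fun x => (p x).toReal) k fun N => countExp (fun x => (q x).toReal) k fun N' =>
        diffExp (fun x => (p x).toReal) (fun x => (q x).toReal) m fun A =>
          diffExp (fun x => (p x).toReal) (fun x => (q x).toReal) m fun B =>
            if ∑ x, (N x + N' x + 1 : ℝ)⁻¹ * A x * B x < t then 1 else 0 := by
  simp only [acceptProb, flatTest, toReal_run_countP, toReal_run_countQ, diffExp, run,
    PMF.pure_apply, eq_comm (a := true), decide_eq_true_iff, apply_ite ENNReal.toReal,
    ENNReal.toReal_one, ENNReal.toReal_zero]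

theorem rejectProb_flatTest (k m : ℕ) (t : ℝ) (p q : PMF X) :
    (flatTest X k m t).rejectProb p q =
      countExp (fun x => (p x).toReal) k fun N => countExp (fun x => (q x).toReal) k fun N' =>
        diffExp (fun x => (p x).toReal) (fun x => (q x).toReal) m fun A =>
          diffExp (fun x => (p x).toReal) (fun x => (q x).toReal) m fun B =>
            if ∑ x, (N x + N' x + 1 : ℝ)⁻¹ * A x * B x < t then 0 else 1 := by
  simp only [rejectProb, flatTest, toReal_run_countP, toReal_run_countQ, diffExp, run,
    PMF.pure_apply, eq_comm (a := false), decide_eq_false_iff_not, apply_ite ENNReal.toReal,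
    ENNReal.toReal_one, ENNReal.toReal_zero, ite_not]

end SampleAlg

/-- The threshold is half of `m² s₀` with `s₀ = ε²/(|X| + 2k)`, the lower bound from
`le_sum_flattened`. The constant `288 = 2 · 36 · 4` makes the second part of the false-acceptance
bound at most `δ/2`. -/
theorem SampleAlg.flatTest_correct {k m : ℕ} {ε δ : ℝ} (hε : 0 < ε) (hδ : 0 < δ) (hδ1 : δ < 1)
    (hm : 288 * ((Fintype.card X : ℝ) + 2 * k) ^ 2 ≤ m ^ 2 * ε ^ 4 * (k + 1) * δ ^ 2)
    (p q : PMF X) :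
    (p = q → 1 - δ ≤ (flatTest X k m
      (m ^ 2 * (ε ^ 2 / (Fintype.card X + 2 * k)) / 2)).acceptProb p q) ∧
    (ε < l1Dist p q → 1 - δ ≤ (flatTest X k m
      (m ^ 2 * (ε ^ 2 / (Fintype.card X + 2 * k)) / 2)).rejectProb p q) := by
  have hsum := acceptProb_add_rejectProb (flatTest X k m
    (m ^ 2 * (ε ^ 2 / (Fintype.card X + 2 * k)) / 2)) p q
  have hP (x : X) : 0 ≤ (p x).toReal := ENNReal.toReal_nonneg
  have hQ (x : X) : 0 ≤ (q x).toReal := ENNReal.toReal_nonneg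
  have hX : 0 < Fintype.card X := Fintype.card_pos_iff.2 ⟨p.support_nonempty.some⟩
  have hX' : (0 : ℝ) < Fintype.card X := Nat.cast_pos.2 hX
  set W := (Fintype.card X : ℝ) + 2 * k with hW_def
  have hW : 0 < W := by positivity
  have hm0 : 0 < m := by
    rcases Nat.eq_zero_or_pos m with rfl | h
    · simp only [Nat.cast_zero, ne_eq, OfNat.ofNat_ne_zero, not_false_eq_true, zero_pow,
        zero_mul] at hm
      nlinarith [pow_pos hW 2]
    · exact h
  have hm' : (0 : ℝ) < m := Nat.cast_pos.2 hm0
  have hβ := countExp_flattened_sq_le hP hQ p.sum_toReal q.sum_toReal k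
  have hs₀ : 0 < ε ^ 2 / W := by positivity
  constructor
  · rintro rfl
    suffices h : (flatTest X k m (m ^ 2 * (ε ^ 2 / W) / 2)).rejectProb p p ≤ δ by linarith
    rw [rejectProb_flatTest]
    calc _ ≤ _ := countExp_mono hP k fun N _ => countExp_mono hP k fun N' _ =>
          diffExp_reject_le hP p.sum_toReal m _ (by positivity)
      _ ≤ m ^ 2 / (m ^ 2 * (ε ^ 2 / W) / 2) ^ 2 * (4 / (k + 1)) := by
          simp only [countExp_const_mul]
          exact mul_le_mul_of_nonneg_left hβ (by positivity)
      _ = 16 * W ^ 2 / (m ^ 2 * ε ^ 4 * (k + 1)) := by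
          field_simp
          ring
      _ ≤ δ := by
          rw [div_le_iff₀ (by positivity)]
          have : m ^ 2 * ε ^ 4 * (k + 1) * δ ^ 2 ≤ m ^ 2 * ε ^ 4 * (k + 1) * δ := by
            gcongr; nlinarith
          nlinarith [pow_pos hW 2]
  · intro hd
    suffices h : (flatTest X k m (m ^ 2 * (ε ^ 2 / W) / 2)).acceptProb p q ≤ δ by linarith
    rw [acceptProb_flatTest]
    calc _ ≤ _ := countExp_mono hP k fun N hN => countExp_mono hQ k fun N' hN' =>
          diffExp_accept_le hP hQ p.sum_toReal q.sum_toReal hm0 (fun x => by positivity) hs₀ hδ hδ1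
            (le_trans (by
              rw [hW_def]
              gcongr
              exact hd.le) (le_sum_flattened k hN hN' fun x => (p x).toReal - (q x).toReal))
      _ ≤ δ / 2 + 36 / (δ * m ^ 2 * (ε ^ 2 / W) ^ 2) * (4 / (k + 1)) := by
          simp only [countExp_add, countExp_const_mul, countExp_const p.sum_toReal,
            countExp_const q.sum_toReal]
          gcongr
      _ = δ / 2 + 144 * W ^ 2 / (δ * (m ^ 2 * ε ^ 4 * (k + 1))) := by
          field_simp
          ring
      _ ≤ δ / 2 + δ / 2 := by
          refine add_le_add_right ((div_le_iff₀ (by positivity)).2 ?_) _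
          linarith
      _ = δ := by ring

end FlattenedTester

/-! ### Choice of the parameters of the `ℓ₁` tester. -/

/-- The number of samples that determine the weights, on a domain of size `n`. -/
noncomputable def flatSize (n : ℕ) : ℕ := ⌈(n : ℝ) ^ (2 / 3 : ℝ)⌉₊

/-- The number of samples for each difference count, on a domain of size `n`. -/
noncomputable def diffSize (n : ℕ) (ε δ : ℝ) : ℕ :=
  ⌈17 * ((n : ℝ) + 2 * flatSize n) / (ε ^ 2 * δ * √(flatSize n + 1))⌉₊

open Classical in
/-- The flattening test with parameters that make it an `ℓ₁`-closeness tester. -/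
noncomputable def flatTester : L1Subroutine := fun X _ ε δ =>
  SampleAlg.flatTest X (flatSize (Fintype.card X)) (diffSize (Fintype.card X) ε δ)
    (diffSize (Fintype.card X) ε δ ^ 2 *
      (ε ^ 2 / (Fintype.card X + 2 * flatSize (Fintype.card X))) / 2)

theorem isL1ClosenessTester_flatTester : IsL1ClosenessTester flatTester := by
  classical
  intro X _ ε δ hε hδ hδ1 p q
  refine SampleAlg.flatTest_correct hε hδ hδ1 ?_ p q
  set n := Fintype.card X
  have h := Nat.le_ceil (17 * ((n : ℝ) + 2 * flatSize n) / (ε ^ 2 * δ * √(flatSize n + 1)))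
  rw [← diffSize, div_le_iff₀ (by positivity)] at h
  have h2 := pow_le_pow_left₀ (by positivity) h 2
  rw [mul_pow, mul_pow, mul_pow, mul_pow, Real.sq_sqrt (by positivity)] at h2
  -- The constant 17 in `diffSize` is chosen for `17² = 289 ≥ 288`.
  calc _ ≤ 17 ^ 2 * ((n : ℝ) + 2 * flatSize n) ^ 2 := by gcongr; norm_num
    _ ≤ _ := h2
    _ = _ := by ring

/-- With `k` weighting samples the difference counts need about `n/√k` samples; `k ≈ n^(2/3)`
balances the two. -/
theorem samples_flatTester_le {X : Type} [Fintype X] [Nonempty X] {ε δ : ℝ} (hε : 0 < ε)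
    (hδ : 0 < δ) : ∃ s : ℕ, (flatTester X ε δ).samples ≤ s ∧
      (s : ℝ) ≤ 8 * (Fintype.card X : ℝ) ^ (2 / 3 : ℝ) * (1 + 26 / (ε ^ 2 * δ)) := by
  classical
  refine ⟨_, SampleAlg.samples_flatTest_le _ _ _, ?_⟩
  have hn : 1 ≤ Fintype.card X := Fintype.card_pos
  set n := Fintype.card X
  have hn' : (1 : ℝ) ≤ n := by exact_mod_cast hn
  set r := (n : ℝ) ^ (2 / 3 : ℝ) with hr
  have hr1 : 1 ≤ r := Real.one_le_rpow hn' (by norm_num)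
  have hk : (flatSize n : ℝ) ≤ r + 1 := (Nat.ceil_lt_add_one (by positivity)).le
  have hkn : (flatSize n : ℝ) ≤ n := by
    refine Nat.cast_le.2 (Nat.ceil_le.2 ?_)
    calc (n : ℝ) ^ (2 / 3 : ℝ) ≤ (n : ℝ) ^ (1 : ℝ) :=
          Real.rpow_le_rpow_of_exponent_le hn' (by norm_num)
      _ = n := Real.rpow_one _
  have hsq : (n : ℝ) ^ (1 / 3 : ℝ) ≤ √(flatSize n + 1) := by
    refine Real.le_sqrt_of_sq_le ?_
    rw [← Real.rpow_natCast, ← Real.rpow_mul (by positivity)]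
    norm_num
    exact (Nat.le_ceil _).trans (by rw [flatSize]; linarith)
  have hnr : (n : ℝ) = r * (n : ℝ) ^ (1 / 3 : ℝ) := by
    rw [hr, ← Real.rpow_add (by positivity)]
    norm_num
  have hn3 : 0 < (n : ℝ) ^ (1 / 3 : ℝ) := by positivity
  have hm : (diffSize n ε δ : ℝ) ≤ 51 * r / (ε ^ 2 * δ) + 1 := by
    refine (Nat.ceil_lt_add_one (by positivity)).le.trans ?_
    refine add_le_add_left ?_ _
    calc _ ≤ 17 * ((n : ℝ) + 2 * n) / (ε ^ 2 * δ * (n : ℝ) ^ (1 / 3 : ℝ)) := by gcongr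
      _ = 51 * (r * (n : ℝ) ^ (1 / 3 : ℝ)) / (ε ^ 2 * δ * (n : ℝ) ^ (1 / 3 : ℝ)) := by
        rw [← hnr]; ring
      _ = _ := by field_simp
  have : 0 ≤ r / (ε ^ 2 * δ) := by positivity
  push_cast
  calc 2 * (flatSize n : ℝ) + 4 * diffSize n ε δ ≤
      2 * (r + 1) + 4 * (51 * r / (ε ^ 2 * δ) + 1) := by gcongr
    _ = 2 * r + 6 + 204 * (r / (ε ^ 2 * δ)) := by ring
    _ ≤ 8 * r + 208 * (r / (ε ^ 2 * δ)) := by linarith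
    _ = _ := by ring

/-! ### Bounding the Earth Mover's Distance by the coarsenings -/

section PartialFlow

variable {M Y : Type} [Fintype M]

/-- `f` is a flow with supply at most `P` and demand at most `Q` that stays in the fibers
of `π`. -/
structure IsPartialFlow (P Q : M → ℝ) (π : M → Y) (f : M → M → ℝ) : Prop where
  nonneg : ∀ x y, 0 ≤ f x y
  supply_le : ∀ x, ∑ y, f x y ≤ P x
  demand_le : ∀ y, ∑ x, f x y ≤ Q y
  eq_zero : ∀ x y, π x ≠ π y → f x y = 0

theorem IsPartialFlow.coarsen {Z : Type} {P Q : M → ℝ} {π : M → Y} {f : M → M → ℝ}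
    (hf : IsPartialFlow P Q π f) {ρ : M → Z} (h : ∀ x y, π x = π y → ρ x = ρ y) :
    IsPartialFlow P Q ρ f :=
  ⟨hf.nonneg, hf.supply_le, hf.demand_le, fun x y hxy => hf.eq_zero x y fun e => hxy (h x y e)⟩

theorem PMF.toReal_map [DecidableEq Y] (p : PMF M) (g : M → Y) (c : Y) :
    (p.map g c).toReal = ∑ x, if g x = c then (p x).toReal else 0 := by
  rw [PMF.map_apply, tsum_fintype, ENNReal.toReal_sum]
  · refine Finset.sum_congr rfl fun x _ => ?_
    simp only [eq_comm (a := c)]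
    split_ifs <;> simp
  · intro x _
    split_ifs
    · exact p.apply_ne_top x
    · exact ENNReal.zero_ne_top

variable [Fintype Y] [DecidableEq Y]

theorem sum_sum_fiber (π : M → Y) (φ : M → ℝ) :
    ∑ c, ∑ x, (if π x = c then φ x else 0) = ∑ x, φ x := by
  rw [Finset.sum_comm]
  simp

/-- A partial flow can be extended by moving as much as possible inside the fibers. -/
theorem IsPartialFlow.exists_extension {P Q : M → ℝ} {π : M → Y} {f : M → M → ℝ}
    (hf : IsPartialFlow P Q π f) {dst : M → M → ℝ} {r : ℝ}
    (hr : ∀ x y, π x = π y → dst x y ≤ r) :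
    ∃ g : M → M → ℝ, IsPartialFlow P Q π g ∧
      ∑ x, ∑ y, g x y = ∑ c, min (∑ x, if π x = c then P x else 0)
        (∑ x, if π x = c then Q x else 0) ∧
      ∑ x, ∑ y, g x y * dst x y ≤ ∑ x, ∑ y, f x y * dst x y +
        r * (∑ x, ∑ y, g x y - ∑ x, ∑ y, f x y) := by
  set P' : M → ℝ := fun x => P x - ∑ y, f x y with hP'
  set Q' : M → ℝ := fun y => Q y - ∑ x, f x y with hQ'
  have hP0 (x : M) : 0 ≤ P' x := sub_nonneg.2 (hf.supply_le x)
  have hQ0 (x : M) : 0 ≤ Q' x := sub_nonneg.2 (hf.demand_le x)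
  set a : Y → ℝ := fun c => ∑ x, if π x = c then P' x else 0 with ha
  set b : Y → ℝ := fun c => ∑ x, if π x = c then Q' x else 0 with hb
  have ha0 (c : Y) : 0 ≤ a c := Finset.sum_nonneg fun x _ => by split_ifs <;> simp [hP0]
  have hb0 (c : Y) : 0 ≤ b c := Finset.sum_nonneg fun x _ => by split_ifs <;> simp [hQ0]
  -- Inside each fiber the residual supply is spread in proportion to the residual demand. Dividing
  -- by the larger of the two totals respects both constraints and moves `ab / max a b = min a b`;
  -- in a fiber with no residual mass, division by zero gives 0.
  set h : M → M → ℝ := fun x y =>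
    if π x = π y then P' x * Q' y / max (a (π x)) (b (π x)) else 0 with hh
  have hh0 (x y : M) : 0 ≤ h x y := by
    simp only [hh]
    split_ifs
    · exact div_nonneg (mul_nonneg (hP0 x) (hQ0 y)) (le_max_of_le_left (ha0 _))
    · exact le_rfl
  have hrow (x : M) : ∑ y, h x y = P' x * (b (π x) / max (a (π x)) (b (π x))) := by
    simp only [hh, hb, Finset.sum_div, Finset.mul_sum, ite_div, mul_ite, zero_div, mul_zero]
    exact Finset.sum_congr rfl fun y _ => by
      simp only [eq_comm (a := π x), mul_div_assoc]
  have hcol (y : M) : ∑ x, h x y = Q' y * (a (π y) / max (a (π y)) (b (π y))) := by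
    have e (x : M) : h x y =
        (if π x = π y then P' x else 0) * (Q' y / max (a (π y)) (b (π y))) := by
      simp only [hh]
      split_ifs with hxy
      · rw [hxy, mul_div_assoc]
      · rw [zero_mul]
    rw [Finset.sum_congr rfl fun x _ => e x, ← Finset.sum_mul]
    simp only [ha]
    ring
  have hmass : ∑ x, ∑ y, h x y = ∑ c, min (a c) (b c) := by
    rw [← sum_sum_fiber π]
    refine Finset.sum_congr rfl fun c _ => ?_
    have e (x : M) : (if π x = c then ∑ y, h x y else 0) =
        (if π x = c then P' x else 0) * (b c / max (a c) (b c)) := by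
      split_ifs with hxc
      · rw [hrow, hxc]
      · rw [zero_mul]
    rw [Finset.sum_congr rfl fun x _ => e x, ← Finset.sum_mul]
    change a c * (b c / max (a c) (b c)) = _
    rcases (le_max_of_le_left (ha0 c) : 0 ≤ max (a c) (b c)).eq_or_lt with h0 | h0
    · have h1 : a c = 0 := le_antisymm ((le_max_left _ _).trans h0.ge) (ha0 c)
      have h2 : b c = 0 := le_antisymm ((le_max_right _ _).trans h0.ge) (hb0 c)
      simp [h1, h2]
    · rw [← mul_div_assoc, div_eq_iff h0.ne', min_mul_max]
  -- As `f` stays in the fibers, it removes equal amounts from the supply and the demand of each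
  -- fiber, so the residual minimum is the original minimum less the mass already moved.
  have hfib (c : Y) : ∑ x, (if π x = c then ∑ y, f x y else 0) =
      ∑ y, (if π y = c then ∑ x, f x y else 0) := by
    have e1 (x : M) : (if π x = c then ∑ y, f x y else 0) =
        ∑ y, if π x = c ∧ π y = c then f x y else 0 := by
      split_ifs with hx
      · refine Finset.sum_congr rfl fun y _ => ?_
        split_ifs with hy
        · rfl
        · exact hf.eq_zero x y fun e => hy ⟨hx, e ▸ hx⟩
      · exact (Finset.sum_eq_zero fun y _ => if_neg fun hy => hx hy.1).symm
    have e2 (y : M) : (if π y = c then ∑ x, f x y else 0) =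
        ∑ x, if π x = c ∧ π y = c then f x y else 0 := by
      split_ifs with hx
      · refine Finset.sum_congr rfl fun x _ => ?_
        split_ifs with hy
        · rfl
        · exact hf.eq_zero x y fun e => hy ⟨e ▸ hx, hx⟩
      · exact (Finset.sum_eq_zero fun y _ => if_neg fun hy => hx hy.2).symm
    rw [Finset.sum_congr rfl fun x _ => e1 x, Finset.sum_congr rfl fun x _ => e2 x,
      Finset.sum_comm]
  have hmin (c : Y) : min (a c) (b c) = min (∑ x, if π x = c then P x else 0)
      (∑ x, if π x = c then Q x else 0) - ∑ x, (if π x = c then ∑ y, f x y else 0) := by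
    rw [← min_sub_sub_right]
    congr 1
    · rw [← Finset.sum_sub_distrib]
      exact Finset.sum_congr rfl fun x _ => by split_ifs <;> simp [hP']
    · rw [hfib, ← Finset.sum_sub_distrib]
      exact Finset.sum_congr rfl fun x _ => by split_ifs <;> simp [hQ']
  have hmass' : ∑ x, ∑ y, h x y = ∑ c, min (∑ x, if π x = c then P x else 0)
      (∑ x, if π x = c then Q x else 0) - ∑ x, ∑ y, f x y := by
    rw [hmass, Finset.sum_congr rfl fun c _ => hmin c, Finset.sum_sub_distrib, sum_sum_fiber]
  refine ⟨fun x y => f x y + h x y, ⟨fun x y => add_nonneg (hf.nonneg x y) (hh0 x y),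
    fun x => ?_, fun y => ?_, fun x y hxy => ?_⟩, ?_, ?_⟩
  · have h1 : P' x * (b (π x) / max (a (π x)) (b (π x))) ≤ P' x := mul_le_of_le_one_right (hP0 x)
      (div_le_one_of_le₀ (le_max_right _ _) (le_max_of_le_left (ha0 _)))
    rw [Finset.sum_add_distrib, hrow]
    linarith [show P' x = P x - ∑ y, f x y from rfl]
  · have h1 : Q' y * (a (π y) / max (a (π y)) (b (π y))) ≤ Q' y := mul_le_of_le_one_right (hQ0 y)
      (div_le_one_of_le₀ (le_max_left _ _) (le_max_of_le_left (ha0 _)))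
    rw [Finset.sum_add_distrib, hcol]
    linarith [show Q' y = Q y - ∑ x, f x y from rfl]
  · simp [hh, hxy, hf.eq_zero x y hxy]
  · simp only [Finset.sum_add_distrib]
    rw [hmass']
    ring
  · simp only [add_mul, Finset.sum_add_distrib, add_sub_cancel_left]
    refine add_le_add_right ?_ _
    simp only [Finset.mul_sum]
    refine Finset.sum_le_sum fun x _ => Finset.sum_le_sum fun y _ => ?_
    by_cases hxy : π x = π y
    · rw [mul_comm]
      exact mul_le_mul_of_nonneg_right (hr x y hxy) (hh0 x y)
    · simp [hh, hxy]

/-- Sums `min a b = (a + b - |a - b|) / 2` over the cells; the mass left unmatched by a maximal flow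
is thus half the `ℓ₁` distance. -/
theorem sum_min_toReal_map (p q : PMF M) (g : M → Y) :
    ∑ c, min (∑ x, if g x = c then (p x).toReal else 0)
      (∑ x, if g x = c then (q x).toReal else 0) = 1 - l1Dist (p.map g) (q.map g) / 2 := by
  simp only [← PMF.toReal_map, l1Dist]
  rw [← Finset.sum_congr rfl fun c _ => (inf_eq_half_smul_add_sub_abs_sub ℝ _ _).symm]
  simp only [smul_eq_mul, ← Finset.mul_sum, Finset.sum_sub_distrib, Finset.sum_add_distrib,
    PMF.sum_toReal, abs_sub_comm (((q.map g) _).toReal)]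
  norm_num
  ring

end PartialFlow

theorem l1Dist_eq_zero_of_subsingleton {X : Type} [Fintype X] [Subsingleton X] (p q : PMF X) :
    l1Dist p q = 0 := by
  refine Finset.sum_eq_zero fun x _ => ?_
  have h (r : PMF X) : (r x).toReal = 1 := by
    rw [← r.sum_toReal, Fintype.sum_subsingleton _ x]
  rw [h, h, sub_self, abs_zero]

theorem emd_le_of_satisfyingFlow {M : Type} [Fintype M] [MetricSpace M] {p q : PMF M}
    {f : M → M → ℝ} (hf : IsSatisfyingFlow p q f) : EMD p q ≤ ∑ x, ∑ y, f x y * dist x y := by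
  refine csInf_le ⟨0, ?_⟩ ⟨f, hf, rfl⟩
  rintro _ ⟨g, hg, rfl⟩
  exact Finset.sum_nonneg fun x _ => Finset.sum_nonneg fun y _ =>
    mul_nonneg (hg.nonneg x y) dist_nonneg

theorem IsPartialFlow.isSatisfyingFlow {M Y : Type} [Fintype M] {p q : PMF M} {π : M → Y}
    {f : M → M → ℝ}
    (hf : IsPartialFlow (fun x => (p x).toReal) (fun x => (q x).toReal) π f)
    (h : ∑ x, ∑ y, f x y = 1) : IsSatisfyingFlow p q f := by
  refine ⟨hf.nonneg, fun x => ?_, fun y => ?_⟩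
  · exact (Finset.sum_eq_sum_iff_of_le fun x _ => hf.supply_le x).1
      (h.trans p.sum_toReal.symm) x (Finset.mem_univ x)
  · exact (Finset.sum_eq_sum_iff_of_le fun y _ => hf.demand_le y).1
      ((Finset.sum_comm.trans h).trans q.sum_toReal.symm) y (Finset.mem_univ y)

/-- The Earth Mover's Distance is controlled by the `ℓ₁` distances of the coarsenings along a
sequence of finer and finer partitions whose cells have diameters `R / 2 ^ i`. -/
theorem emd_le_of_l1Dist_le {M : Type} [Fintype M] [MetricSpace M] {Y : ℕ → Type}
    [∀ i, Fintype (Y i)] [Subsingleton (Y 0)] (π : ∀ i, M → Y i) {R η : ℝ}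
    (hπ : ∀ i x y, π (i + 1) x = π (i + 1) y → π i x = π i y)
    (hR : ∀ i x y, π i x = π i y → dist x y ≤ R / 2 ^ i) (p q : PMF M) (L : ℕ)
    (hη : ∀ i, 1 ≤ i → i ≤ L → R / 2 ^ i * (l1Dist (p.map (π i)) (q.map (π i)) / 2) ≤ η) :
    EMD p q ≤ R / 2 ^ L + L * η := by
  classical
  -- Induction from the finest scale down to `i = 0`. The invariant charges all unmatched mass at
  -- the current diameter. Coarsening by one level doubles that charge, and the increase is exactly
  -- the quantity bounded by `η` at level `i + 1`.
  have key (j : ℕ) : ∀ i, i + j = L → ∃ f : M → M → ℝ,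
      IsPartialFlow (fun x => (p x).toReal) (fun x => (q x).toReal) (π i) f ∧
      ∑ x, ∑ y, f x y = 1 - l1Dist (p.map (π i)) (q.map (π i)) / 2 ∧
      ∑ x, ∑ y, f x y * dist x y +
        R / 2 ^ i * (l1Dist (p.map (π i)) (q.map (π i)) / 2) ≤ R / 2 ^ L + j * η := by
    induction j with
    | zero =>
      rintro i rfl
      have h0 : IsPartialFlow (fun x => (p x).toReal) (fun x => (q x).toReal) (π i) fun _ _ => 0 :=
        ⟨by simp, by simp, by simp, by simp⟩
      obtain ⟨g, hg, hm, hc⟩ := h0.exists_extension (hR i)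
      rw [sum_min_toReal_map] at hm
      refine ⟨g, hg, hm, ?_⟩
      rw [hm] at hc
      simp only [zero_mul, Finset.sum_const_zero, sub_zero, zero_add] at hc
      simp only [add_zero, Nat.cast_zero, zero_mul]
      linarith
    | succ j ih =>
      intro i hi
      obtain ⟨f, hf, hfm, hfc⟩ := ih (i + 1) (by omega)
      obtain ⟨g, hg, hm, hc⟩ := (hf.coarsen (hπ i)).exists_extension (hR i)
      rw [sum_min_toReal_map] at hm
      refine ⟨g, hg, hm, ?_⟩
      have h1 := hη (i + 1) (by omega) (by omega)
      have e : R / 2 ^ i = 2 * (R / 2 ^ (i + 1)) := by rw [pow_succ]; field_simp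
      rw [hm, hfm, e] at hc
      rw [e]
      push_cast
      linarith
  obtain ⟨f, hf, hm, hc⟩ := key L 0 (by omega)
  -- At scale 0 there is at most one cell, so nothing is left unmatched and the flow is complete.
  rw [l1Dist_eq_zero_of_subsingleton] at hm hc
  refine (emd_le_of_satisfyingFlow (hf.isSatisfyingFlow (by simpa using hm))).trans ?_
  simpa using hc

/-! ### The grids -/

theorem gridCell_eq_of_succ {d : ℕ} {Δ : ℝ} {i : ℕ} {x y : L1Space d}
    (h : gridCell Δ (i + 1) x = gridCell Δ (i + 1) y) : gridCell Δ i x = gridCell Δ i y := by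
  -- Coarse indices are the halves of fine ones, and halving is compatible with capping at `2^(i+1)
  -- - 1` and `2^i - 1`.
  have hfl (u : ℝ) : ⌊u / (Δ / 2 ^ i)⌋₊ = ⌊u / (Δ / 2 ^ (i + 1))⌋₊ / 2 := by
    rw [← Nat.floor_div_ofNat]
    congr 1
    rw [pow_succ]
    field_simp
  ext j
  have hj := congrArg Fin.val (congrFun h j)
  simp only [gridCell] at hj ⊢
  rw [hfl, hfl]
  have := Nat.two_pow_pos i
  rw [pow_succ] at hj
  rw [pow_succ]
  omega

theorem dist_le_of_gridCell_eq {d : ℕ} {Δ : ℝ} (hΔ : 0 < Δ) {i : ℕ} {x y : L1Space d}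
    (hx : ∀ j, x j ∈ Set.Icc 0 Δ) (hy : ∀ j, y j ∈ Set.Icc 0 Δ)
    (h : gridCell Δ i x = gridCell Δ i y) : dist x y ≤ Δ * d / 2 ^ i := by
  have hw : 0 < Δ / 2 ^ i := by positivity
  have hb (u : ℝ) (hu : u ∈ Set.Icc 0 Δ) :
      ((min ⌊u / (Δ / 2 ^ i)⌋₊ (2 ^ i - 1) : ℕ) : ℝ) ≤ u / (Δ / 2 ^ i) ∧
      u / (Δ / 2 ^ i) ≤ ((min ⌊u / (Δ / 2 ^ i)⌋₊ (2 ^ i - 1) : ℕ) : ℝ) + 1 := by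
    have h0 : 0 ≤ u / (Δ / 2 ^ i) := div_nonneg hu.1 hw.le
    refine ⟨(Nat.cast_le.2 (min_le_left _ _)).trans (Nat.floor_le h0), ?_⟩
    rcases min_cases ⌊u / (Δ / 2 ^ i)⌋₊ (2 ^ i - 1) with ⟨e, -⟩ | ⟨e, -⟩
    · rw [e]; exact (Nat.lt_floor_add_one _).le
    -- In the last cell the index plus one is `2^i`, so the upper bound is just `u ≤ Δ`.
    · rw [e, Nat.cast_sub Nat.one_le_two_pow, div_le_iff₀ hw]
      push_cast
      rw [sub_add_cancel, mul_div_cancel₀ _ (by positivity)]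
      exact hu.2
  rw [PiLp.dist_eq_of_L1]
  calc ∑ j, dist (x j) (y j) ≤ ∑ _j : Fin d, Δ / 2 ^ i := Finset.sum_le_sum fun j _ => by
        have hj := congrArg Fin.val (congrFun h j)
        simp only [gridCell] at hj
        obtain ⟨h1, h2⟩ := hb _ (hx j)
        obtain ⟨h3, h4⟩ := hb _ (hy j)
        rw [hj] at h1 h2
        rw [Real.dist_eq, ← div_le_one₀ hw, ← abs_of_pos hw, ← abs_div, sub_div, abs_le]
        constructor <;> linarith
    _ = Δ * d / 2 ^ i := by simp; ring

theorem le_two_pow_numScales {d : ℕ} {Δ ε : ℝ} (hΔ : 0 < Δ) (hε : 0 < ε) :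
    2 * Δ * d / ε ≤ 2 ^ numScales d Δ ε := by
  rcases Nat.eq_zero_or_pos d with rfl | hd
  · simp
  · have hd' : (0 : ℝ) < d := Nat.cast_pos.2 hd
    have h : Real.logb 2 (2 * Δ * d / ε) ≤ numScales d Δ ε := Nat.le_ceil _
    rwa [Real.logb_le_iff_le_rpow one_lt_two (by positivity), Real.rpow_natCast] at h

/-! ### Correctness -/

theorem isEMDClosenessTester_emdClosenessTester {T : L1Subroutine} (hT : IsL1ClosenessTester T)
    (d : ℕ) {Δ : ℝ} (hΔ : 0 < Δ) (M : Finset (L1Space d)) (hM : ∀ x ∈ M, ∀ j, x j ∈ Set.Icc 0 Δ) :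
    IsEMDClosenessTester (M := M) fun ε => (emdClosenessTester T d Δ ε).comap Subtype.val := by
  intro ε hε p q
  set L := numScales d Δ ε with hL
  rw [SampleAlg.acceptProb_comap, SampleAlg.rejectProb_comap]
  set t : ℕ → SampleAlg (L1Space d) Bool := fun i =>
    (T (GridCell d i) (ε * (2 : ℝ) ^ ((i : ℤ) - 2) / (Δ * d * L)) (1 / (3 * L))).comap
      (gridCell Δ i) with ht
  have hA : emdClosenessTester T d Δ ε = SampleAlg.allAccept ((List.range' 1 L).map t) := rfl
  have hLd (i : ℕ) (hi : i ∈ List.range' 1 L) :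
      0 < (L : ℝ) ∧ 0 < (d : ℝ) ∧ 1 ≤ i ∧ i ≤ L := by
    rw [List.mem_range'_1] at hi
    have h1 : 0 < L := by omega
    refine ⟨Nat.cast_pos.2 h1, ?_, hi.1, by omega⟩
    rcases Nat.eq_zero_or_pos d with rfl | hd
    · simp [hL, numScales] at h1
    · exact Nat.cast_pos.2 hd
  have hδ (i : ℕ) (hi : i ∈ List.range' 1 L) :
      0 < ε * (2 : ℝ) ^ ((i : ℤ) - 2) / (Δ * d * L) ∧ (0 : ℝ) < 1 / (3 * L) ∧
        (1 : ℝ) / (3 * L) ≤ 1 / 3 := by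
    obtain ⟨h1, h2, -⟩ := hLd i hi
    have h3 : (1 : ℝ) ≤ L := by exact_mod_cast Nat.cast_pos.1 h1
    refine ⟨by positivity, by positivity, ?_⟩
    gcongr
    linarith
  have htest (i : ℕ) (hi : i ∈ List.range' 1 L) := by
    obtain ⟨h1, h2, h3⟩ := hδ i hi
    exact hT (GridCell d i) _ _ h1 h2 (by linarith) ((p.map Subtype.val).map (gridCell Δ i))
      ((q.map Subtype.val).map (gridCell Δ i))
  constructor
  · rintro rfl
    rw [hA]
    refine le_trans ?_ (SampleAlg.one_sub_le_acceptProb_allAccept (δ := 1 / (3 * L)) ?_)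
    · rw [List.length_map, List.length_range']
      -- For `L = 0` no test is run and the algorithm always accepts; otherwise the total error is
      -- `L · 1/(3L)`.
      rcases Nat.eq_zero_or_pos L with h0 | h0
      · rw [h0]; norm_num
      · have : (0 : ℝ) < L := Nat.cast_pos.2 h0
        have e : (L : ℝ) * (1 / (3 * L)) = 1 / 3 := by field_simp
        rw [e]; norm_num
    · intro A hA
      obtain ⟨i, hi, rfl⟩ := List.mem_map.1 hA
      rw [ht, SampleAlg.acceptProb_comap]
      exact (htest i hi).1 rfl
  · intro hemd
    have hex : ∃ i ∈ List.range' 1 L, ε * (2 : ℝ) ^ ((i : ℤ) - 2) / (Δ * d * L) <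
        l1Dist ((p.map Subtype.val).map (gridCell Δ i))
          ((q.map Subtype.val).map (gridCell Δ i)) := by
      -- If no scale exceeds its threshold, then EMD is at most `ε/2 + L · ε/(8L)`, less than `ε`.
      -- The value of `η` is half the threshold times the cell diameter. For `L = 0` the first term
      -- alone suffices.
      by_contra! hall
      have hsub : Subsingleton (GridCell d 0) :=
        inferInstanceAs (Subsingleton (Fin d → Fin 1))
      have hbd := emd_le_of_l1Dist_le (Y := GridCell d) (R := Δ * d) (η := ε / (8 * L))
        (fun i (x : M) => gridCell Δ i x.1)
        (fun i x y => gridCell_eq_of_succ)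
        (fun i x y h => dist_le_of_gridCell_eq hΔ (hM x x.2) (hM y y.2) h) p q L fun i h1 h2 => by
          have hi : i ∈ List.range' 1 L := List.mem_range'_1.2 ⟨h1, by omega⟩
          obtain ⟨h3, h4, -⟩ := hLd i hi
          have h := hall i hi
          simp only [PMF.map_comp, Function.comp_def] at h
          calc _ ≤ Δ * d / 2 ^ i * (ε * (2 : ℝ) ^ ((i : ℤ) - 2) / (Δ * d * L) / 2) := by gcongr
            _ = ε / (8 * L) := by
              rw [zpow_sub₀ two_ne_zero, zpow_natCast]
              field_simp
              norm_num
      have h2L := le_two_pow_numScales (d := d) hΔ hε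
      rw [← hL, div_le_iff₀ hε] at h2L
      have h1 : Δ * d / 2 ^ L ≤ ε / 2 := by
        rw [div_le_iff₀ (by positivity)]
        linarith
      have h2 : L * (ε / (8 * L)) ≤ ε / 8 := by
        rcases Nat.eq_zero_or_pos L with h0 | h0
        · rw [h0]; simp; positivity
        · have : (0 : ℝ) < L := Nat.cast_pos.2 h0
          apply le_of_eq; field_simp
      linarith
    obtain ⟨i, hi, hd⟩ := hex
    have h1 := (htest i hi).2 hd
    rw [← SampleAlg.rejectProb_comap] at h1
    change 1 - _ ≤ (t i).rejectProb _ _ at h1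
    have h2 := SampleAlg.acceptProb_allAccept_le (List.mem_map_of_mem (f := t) hi)
      (p.map Subtype.val) (q.map Subtype.val)
    have h3 := (t i).acceptProb_add_rejectProb (p.map Subtype.val) (q.map Subtype.val)
    have h4 := (SampleAlg.allAccept ((List.range' 1 L).map t)).acceptProb_add_rejectProb
      (p.map Subtype.val) (q.map Subtype.val)
    have h5 := (hδ i hi).2.2
    rw [hA]
    linarith

/-! ### Sample complexity -/

theorem SampleAlg.samples_allAccept_le_floor {X : Type} {l : List (SampleAlg X Bool)} {B K : ℝ}
    (h : ∀ A ∈ l, ∃ s : ℕ, A.samples ≤ s ∧ (s : ℝ) ≤ B) (hK : l.length * B ≤ K) :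
    (allAccept l).samples ≤ (⌊K⌋₊ : ℕ∞) := by
  have hl : ∃ s : ℕ, (l.map samples).sum ≤ s ∧ (s : ℝ) ≤ l.length * B := by
    clear hK
    induction l with
    | nil => exact ⟨0, by simp⟩
    | cons A As ih =>
      obtain ⟨s, hs, hsB⟩ := ih fun C hC => h C (List.mem_cons_of_mem _ hC)
      obtain ⟨t, ht, htB⟩ := h A List.mem_cons_self
      refine ⟨t + s, ?_, ?_⟩
      · rw [List.map_cons, List.sum_cons, Nat.cast_add]
        exact add_le_add ht hs
      · rw [List.length_cons]
        push_cast
        linarith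
  obtain ⟨s, hs, hsB⟩ := hl
  exact (samples_allAccept_le l).trans
    (hs.trans (Nat.cast_le.2 (Nat.le_floor (hsB.trans hK))))

theorem one_lt_of_numScales_pos {d : ℕ} {Δ ε : ℝ} (hΔ : 0 < Δ) (hε : 0 < ε)
    (hL : 0 < numScales d Δ ε) :
    1 < 2 * Δ * d / ε ∧ (2 : ℝ) ^ numScales d Δ ε ≤ 2 * (2 * Δ * d / ε) ∧
      (numScales d Δ ε : ℝ) ≤ 1 + 2 * Real.log (2 * Δ * d / ε) := by
  have h0 : 0 < Real.logb 2 (2 * Δ * d / ε) := Nat.ceil_pos.1 hL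
  have hx : 1 < 2 * Δ * d / ε := by
    by_contra! h
    exact h0.not_ge (Real.logb_nonpos one_lt_two (by positivity) h)
  set x := 2 * Δ * d / ε with hx_def
  have hc : (numScales d Δ ε : ℝ) ≤ Real.logb 2 x + 1 := (Nat.ceil_lt_add_one h0.le).le
  refine ⟨hx, ?_, ?_⟩
  · calc (2 : ℝ) ^ numScales d Δ ε = (2 : ℝ) ^ (numScales d Δ ε : ℝ) :=
          (Real.rpow_natCast _ _).symm
      _ ≤ (2 : ℝ) ^ (Real.logb 2 x + 1) := Real.rpow_le_rpow_of_exponent_le one_le_two hc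
      _ = 2 * x := by
          rw [Real.rpow_add two_pos, Real.rpow_logb two_pos (by norm_num) (by linarith),
            Real.rpow_one, mul_comm]
  · have hlog : Real.logb 2 x ≤ 2 * Real.log x := by
      have hl2 := Real.log_two_gt_d9
      rw [Real.logb, div_le_iff₀ (by linarith)]
      nlinarith [Real.log_pos hx]
    linarith

/-- Here `B` bounds the cost of every single scale: the number of cells to the power `2/3`, times
the inverse square of the relative accuracy. Of the four factors `L`, two come from the squared
distance parameter, one from the failure probability and one from the number of scales. -/
theorem samples_emdClosenessTester_flatTester_le {d : ℕ} {Δ ε B K : ℝ} (hΔ : 0 < Δ) (hε : 0 < ε)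
    (hB : ∀ i, i ≤ numScales d Δ ε →
      ((2 : ℝ) ^ i) ^ (2 * (d : ℝ) / 3) * (2 ^ (numScales d Δ ε - i)) ^ 2 ≤ B)
    (hK : 2504 * (numScales d Δ ε : ℝ) ^ 4 * B ≤ K) :
    (emdClosenessTester flatTester d Δ ε).samples ≤ (⌊K⌋₊ : ℕ∞) := by
  set L := numScales d Δ ε with hL
  refine SampleAlg.samples_allAccept_le_floor (B := 2504 * (L : ℝ) ^ 3 * B) ?_ ?_
  · intro A hA
    obtain ⟨i, hi, rfl⟩ := List.mem_map.1 hA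
    rw [List.mem_range'_1] at hi
    have hL0 : 0 < L := by omega
    have hi2 : i ≤ L := by omega
    obtain ⟨hx1, -, -⟩ := one_lt_of_numScales_pos hΔ hε hL0
    have hL1 : (1 : ℝ) ≤ L := by exact_mod_cast hL0
    have hd : (0 : ℝ) < d := by
      rcases Nat.eq_zero_or_pos d with rfl | hd
      · norm_num at hx1
      · exact Nat.cast_pos.2 hd
    obtain ⟨s, hs, hsB⟩ := samples_flatTester_le (X := GridCell d i)
      (ε := ε * (2 : ℝ) ^ ((i : ℤ) - 2) / (Δ * d * L)) (δ := 1 / (3 * L))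
      (by positivity) (by positivity)
    refine ⟨s, (SampleAlg.samples_comap_le _ _).trans hs, hsB.trans ?_⟩
    have hcard : (Fintype.card (GridCell d i) : ℝ) ^ (2 / 3 : ℝ) =
        ((2 : ℝ) ^ i) ^ (2 * (d : ℝ) / 3) := by
      rw [Fintype.card_fun, Fintype.card_fin, Fintype.card_fin, Nat.cast_pow, Nat.cast_pow,
        Nat.cast_ofNat, ← Real.rpow_natCast, ← Real.rpow_mul (by positivity)]
      congr 1
      ring
    set u : ℝ := (2 ^ (L - i)) ^ 2 with hu
    have hu1 : 1 ≤ u := one_le_pow₀ (one_le_pow₀ one_le_two)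
    have hL3 : (1 : ℝ) ≤ (L : ℝ) ^ 3 := one_le_pow₀ hL1
    -- `312 = 26 · 3 · 16 / 4`, where the 4 comes from rewriting `Δd/ε` as half of `2Δd/ε`; then
    -- `2504 = 8 · (1 + 312)`.
    have hpar : 26 / ((ε * (2 : ℝ) ^ ((i : ℤ) - 2) / (Δ * d * L)) ^ 2 * (1 / (3 * L))) ≤
        312 * (L : ℝ) ^ 3 * u := by
      have h2L := le_two_pow_numScales (d := d) hΔ hε
      rw [← hL] at h2L
      have hsplit : (2 : ℝ) ^ L = 2 ^ (L - i) * 2 ^ i := by rw [← pow_add]; congr 1; omega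
      calc _ = 312 * (L : ℝ) ^ 3 * ((2 * Δ * d / ε) ^ 2 / (2 ^ i) ^ 2) := by
            rw [zpow_sub₀ two_ne_zero, zpow_natCast]
            field_simp
            norm_num
        _ ≤ 312 * (L : ℝ) ^ 3 * ((2 ^ L) ^ 2 / (2 ^ i) ^ 2) := by gcongr
        _ = _ := by
            rw [hsplit, hu]
            field_simp
    rw [hcard]
    calc 8 * ((2 : ℝ) ^ i) ^ (2 * (d : ℝ) / 3) * (1 + _) ≤
        8 * ((2 : ℝ) ^ i) ^ (2 * (d : ℝ) / 3) * ((L : ℝ) ^ 3 * u + 312 * (L : ℝ) ^ 3 * u) := by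
          gcongr
          nlinarith
      _ = 2504 * (L : ℝ) ^ 3 * (((2 : ℝ) ^ i) ^ (2 * (d : ℝ) / 3) * u) := by ring
      _ ≤ _ := by gcongr; exact hB i hi2
  · rw [List.length_map, List.length_range']
    refine le_trans (le_of_eq ?_) hK
    ring

theorem samples_emdClosenessTester_flatTester_le_of_six_le {d : ℕ} (hd : 6 ≤ d) {Δ ε : ℝ}
    (hΔ : 0 < Δ) (hε : 0 < ε) {K : ℝ}
    (hK : 2504 * (numScales d Δ ε : ℝ) ^ 4 * (2 ^ numScales d Δ ε) ^ (2 * (d : ℝ) / 3) ≤ K) :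
    (emdClosenessTester flatTester d Δ ε).samples ≤ (⌊K⌋₊ : ℕ∞) := by
  refine samples_emdClosenessTester_flatTester_le hΔ hε (fun i hi => ?_) hK
  have hd' : (6 : ℝ) ≤ d := by exact_mod_cast hd
  calc _ ≤ ((2 : ℝ) ^ i) ^ (2 * (d : ℝ) / 3) *
        (2 ^ (numScales d Δ ε - i)) ^ (2 * (d : ℝ) / 3) := by
        gcongr
        rw [← Real.rpow_natCast ((2 : ℝ) ^ (numScales d Δ ε - i)) 2]
        exact Real.rpow_le_rpow_of_exponent_le (one_le_pow₀ one_le_two) (by push_cast; linarith)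
    _ = _ := by
        rw [← Real.mul_rpow (by positivity) (by positivity), ← pow_add, Nat.add_sub_cancel' hi]

theorem samples_emdClosenessTester_flatTester_le_of_le_two {d : ℕ} (hd : d ≤ 2) {Δ ε : ℝ}
    (hΔ : 0 < Δ) (hε : 0 < ε) {K : ℝ}
    (hK : 2504 * (numScales d Δ ε : ℝ) ^ 4 * (2 ^ numScales d Δ ε) ^ 2 ≤ K) :
    (emdClosenessTester flatTester d Δ ε).samples ≤ (⌊K⌋₊ : ℕ∞) := by
  refine samples_emdClosenessTester_flatTester_le hΔ hε (fun i hi => ?_) hK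
  have hd' : (d : ℝ) ≤ 2 := by exact_mod_cast hd
  calc _ ≤ ((2 : ℝ) ^ i) ^ 2 * (2 ^ (numScales d Δ ε - i)) ^ 2 := by
        gcongr
        rw [← Real.rpow_natCast ((2 : ℝ) ^ i) 2]
        exact Real.rpow_le_rpow_of_exponent_le (one_le_pow₀ one_le_two) (by push_cast; linarith)
    _ = _ := by rw [← mul_pow, ← pow_add, Nat.add_sub_cancel' hi]

theorem numScales_le_log {d : ℕ} {Δ ε : ℝ} (hΔ : 0 < Δ) (hε : 0 < ε) :
    (numScales d Δ ε : ℝ) ≤ 3 * Real.log (2 + 2 * Δ * d / ε) := by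
  have hx0 : 0 ≤ 2 * Δ * d / ε := by positivity
  rcases Nat.eq_zero_or_pos (numScales d Δ ε) with h0 | h0
  · rw [h0, Nat.cast_zero]
    exact mul_nonneg (by norm_num) (Real.log_nonneg (by linarith))
  · obtain ⟨hx, -, hL⟩ := one_lt_of_numScales_pos hΔ hε h0
    -- Here `2Δd/ε > 1`, so the argument exceeds `3 > e`, and the additive 1 is absorbed into the
    -- logarithm.
    have h1 : 1 ≤ Real.log (2 + 2 * Δ * d / ε) := by
      rw [Real.le_log_iff_exp_le (by linarith)]
      linarith [Real.exp_one_lt_d9]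
    have h2 : Real.log (2 * Δ * d / ε) ≤ Real.log (2 + 2 * Δ * d / ε) :=
      Real.log_le_log (by linarith) (by linarith)
    linarith

theorem numScales_le_log_of_le_two {d : ℕ} (hd : d ≤ 2) {Δ ε : ℝ} (hΔ : 0 < Δ) (hε : 0 < ε) :
    (numScales d Δ ε : ℝ) ≤ 8 * Real.log (2 + Δ / ε) := by
  have hy0 : 0 < Δ / ε := by positivity
  have hl2 := Real.log_two_gt_d9
  have h2y : Real.log 2 ≤ Real.log (2 + Δ / ε) := Real.log_le_log two_pos (by linarith)
  rcases Nat.eq_zero_or_pos (numScales d Δ ε) with h0 | h0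
  · rw [h0, Nat.cast_zero]
    linarith
  · obtain ⟨hx, -, hL⟩ := one_lt_of_numScales_pos hΔ hε h0
    have hd' : (d : ℝ) ≤ 2 := by exact_mod_cast hd
    have hxy : 2 * Δ * d / ε ≤ 2 ^ 2 * (2 + Δ / ε) := by
      calc 2 * Δ * d / ε ≤ 2 * Δ * 2 / ε := by gcongr
        _ = 4 * (Δ / ε) := by ring
        _ ≤ _ := by linarith
    have h3 := Real.log_le_log (by linarith) hxy
    rw [Real.log_mul (by norm_num) (by linarith), Real.log_pow] at h3
    push_cast at h3
    linarith

theorem theorem12 :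
    -- correctness, for every choice of the `ℓ₁`-closeness tester used as a subroutine
    (∀ T : L1Subroutine, IsL1ClosenessTester T →
      ∀ (d : ℕ) (Δ : ℝ), 0 < Δ →
      ∀ M : Finset (L1Space d), (∀ x ∈ M, ∀ j, x j ∈ Set.Icc 0 Δ) →
        IsEMDClosenessTester (M := M)
          fun ε => (emdClosenessTester T d Δ ε).comap Subtype.val) ∧
    -- sample complexity, for a suitable choice of the subroutine
    (∃ T : L1Subroutine, IsL1ClosenessTester T ∧ ∃ k : ℕ,
      -- fixed `d ≥ 6`
      (∀ d : ℕ, 6 ≤ d → ∃ C : ℝ, ∀ Δ ε : ℝ, 0 < Δ → 0 < ε →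
        (emdClosenessTester T d Δ ε).samples ≤
          (⌊C * (2 * Δ * d / ε) ^ (2 * (d : ℝ) / 3) *
            Real.log (2 + 2 * Δ * d / ε) ^ k⌋₊ : ℕ∞)) ∧
      -- uniformly in `d ≥ 6`, with `2Δd/ε` rounded up to a power of two
      (∃ C : ℝ, ∀ d : ℕ, 6 ≤ d → ∀ Δ ε : ℝ, 0 < Δ → 0 < ε →
        (emdClosenessTester T d Δ ε).samples ≤
          (⌊C * ((2 : ℝ) ^ numScales d Δ ε) ^ (2 * (d : ℝ) / 3) *
            (d * Real.log (2 + 2 * Δ * d / ε)) ^ k⌋₊ : ℕ∞)) ∧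
      -- `d ≤ 2`
      (∃ C : ℝ, ∀ d : ℕ, d ≤ 2 → ∀ Δ ε : ℝ, 0 < Δ → 0 < ε →
        (emdClosenessTester T d Δ ε).samples ≤
          (⌊C * (Δ / ε) ^ 2 * Real.log (2 + Δ / ε) ^ k⌋₊ : ℕ∞))) := by
  refine ⟨fun T hT d Δ hΔ M hM => isEMDClosenessTester_emdClosenessTester hT d hΔ M hM,
    flatTester, isL1ClosenessTester_flatTester, 4, fun d hd => ?_, ?_, ?_⟩
  -- The factor `2^(2d/3)` pays for rounding `2Δd/ε` up to `2^L`; it is why this constant depends on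
  -- `d`.
  · refine ⟨2504 * 3 ^ 4 * 2 ^ (2 * (d : ℝ) / 3), fun Δ ε hΔ hε => ?_⟩
    refine samples_emdClosenessTester_flatTester_le_of_six_le hd hΔ hε ?_
    have hlog := numScales_le_log (d := d) hΔ hε
    -- The bound `2^L ≤ 2 · (2Δd/ε)` is available only for `L > 0`; for `L = 0` the factor `L⁴`
    -- makes the left side vanish.
    rcases Nat.eq_zero_or_pos (numScales d Δ ε) with h0 | h0
    · rw [h0]
      simp only [Nat.cast_zero, ne_eq, OfNat.ofNat_ne_zero, not_false_eq_true, zero_pow, mul_zero,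
        zero_mul]
      positivity
    · obtain ⟨hx, hL, -⟩ := one_lt_of_numScales_pos hΔ hε h0
      calc _ ≤ 2504 * (3 * Real.log (2 + 2 * Δ * d / ε)) ^ 4 *
            (2 * (2 * Δ * d / ε)) ^ (2 * (d : ℝ) / 3) := by gcongr
        _ = _ := by
            rw [Real.mul_rpow two_pos.le (by linarith)]
            ring
  · refine ⟨2504 * 3 ^ 4, fun d hd Δ ε hΔ hε => ?_⟩
    refine samples_emdClosenessTester_flatTester_le_of_six_le hd hΔ hε ?_
    have hlog := numScales_le_log (d := d) hΔ hε
    have hlog0 : 0 ≤ Real.log (2 + 2 * Δ * d / ε) := by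
      linarith [(Nat.cast_nonneg (numScales d Δ ε) : (0 : ℝ) ≤ numScales d Δ ε)]
    have hd1 : (1 : ℝ) ≤ d := by exact_mod_cast (by omega : 1 ≤ d)
    calc _ ≤ 2504 * (3 * (d * Real.log (2 + 2 * Δ * d / ε))) ^ 4 *
          (2 ^ numScales d Δ ε) ^ (2 * (d : ℝ) / 3) := by
          gcongr
          nlinarith
      _ = _ := by ring
  -- `8 ^ 4` comes from `L ≤ 8 log (2 + Δ/ε)`, and `8 ^ 2` from `2^L ≤ 8Δ/ε`, valid for `d ≤ 2` and
  -- `L > 0`.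
  · refine ⟨2504 * 8 ^ 4 * 8 ^ 2, fun d hd Δ ε hΔ hε => ?_⟩
    refine samples_emdClosenessTester_flatTester_le_of_le_two hd hΔ hε ?_
    have hlog := numScales_le_log_of_le_two hd hΔ hε
    rcases Nat.eq_zero_or_pos (numScales d Δ ε) with h0 | h0
    · rw [h0]
      simp only [Nat.cast_zero, ne_eq, OfNat.ofNat_ne_zero, not_false_eq_true, zero_pow, mul_zero,
        zero_mul]
      positivity
    · obtain ⟨hx, hL, -⟩ := one_lt_of_numScales_pos hΔ hε h0
      have hd' : (d : ℝ) ≤ 2 := by exact_mod_cast hd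
      have hL' : (2 : ℝ) ^ numScales d Δ ε ≤ 8 * (Δ / ε) := by
        calc _ ≤ 2 * (2 * Δ * d / ε) := hL
          _ ≤ 2 * (2 * Δ * 2 / ε) := by gcongr
          _ = _ := by ring
      calc _ ≤ 2504 * (8 * Real.log (2 + Δ / ε)) ^ 4 * (8 * (Δ / ε)) ^ 2 := by gcongr
        _ = _ := by ring
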